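/- Let $n_0,n_1,n_2\ge 1$ be integers and let $G=\theta_{n_0,n_1,n_2}$ be the theta graph, i.e. the finite multigraph obtained by joining two vertices by three internally disjoint paths (strands) of lengths $n_0,n_1,n_2$. Its genus is $g=|E(G)|-|V(G)|+1=2$. For $0\le i\le n_\alpha$ let $v_{\alpha,i}$ be the vertex at distance $i$ along the $\alpha$-th strand from the first of the two end vertices (the same one for all strands); the interior of the strand consists of the $v_{\alpha,i}$ with $0<i<n_\alpha$. Divisors on $G$ are elements of the free abelian group on $V(G)$, $\sim$ is linear equivalence (equivalence under chip-firing), $\operatorname{Jac}(G)$ is the group of classes of divisors of degree $0$, and $r$ is the Baker–Norine rank: $r(D)$ is the largest integer $r\ge -1$ such that $D-F$ is equivalent to an effective divisor for every effective divisor $F$ of degree $r$. For marked vertices $u,v$ put $$\Delta(D)=r(D)-r(D-u)-r(D-v)+r(D-u-v).$$ A divisor $D$ is submodular (with respect to $u,v$) if $\Delta(D+au+bv)\ge 0$ for all $a,b\in\mathbb Z$. The transmission permutation of $D$, if it exists, is the bijection $\tau=\tau_D^{u,v}:\mathbb Z\to\mathbb Z$ such that for all $a,b\in\mathbb Z$ one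 has $\Delta(D+au-bv)=1$ if $\tau(b)=a$ and $\Delta(D+au-bv)=0$ otherwise. An inversion of $\tau$ is a pair of integers $a<b$ with $\tau(a)>\tau(b)$; for a positive integer $k$, $\operatorname{inv}_k(\tau)$ is the number of classes of inversions, where $(a,b)$ and $(a',b')$ are in the same class if $a-a'=b-b'\equiv 0 \pmod k$. The graph $(G,u,v)$ has $k$-general transmission if $ku\sim kv$ and every divisor $D$ on $G$ is submodular, has a transmission permutation, and satisfies $\operatorname{inv}_k(\tau_D^{u,v})\le g$. Then: 1. If $u$ and $v$ lie in the interiors of distinct strands of $G$, then every divisor on $G$ is submodular with respect to $u,v$. 2. Let $u=v_{\alpha,i}$ and $v=v_{\beta,j}$ be evenly marked, that is, $\alpha\ne\beta$, $0<i<n_\alpha$ and $\frac{i}{n_\alpha}=\frac{j}{n_\beta}$. Let $a,b$ be positive integers such that $u$ and $v$ divide their strands in the ratio $\frac ab$, that is, $\frac{i}{n_\alpha-i}=\frac ab$ (equivalently $\frac{j}{n_\beta-j}=\frac ab$). Then $k=\frac{a+b}{\gcd(a,b)}$ is the order of $[u-v]$ in $\operatorname{Jac}(G)$, and $(G,u,v)$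 has $k$-general transmission. -/

import Mathlib

namespace ChipFiring

noncomputable section

section Divisors

variable {V E : Type*}

/-- The group `Div(G)` of divisors on the multigraph `G`. All graphs considered here are finite;
divisors on `G` are then integer-valued functions on its vertex set. -/
abbrev Divisor (G : Graph V E) : Type _ := G.vertexSet → ℤ

/-- The number of edges of `G` joining `x` and `y`. -/
def multiplicity (G : Graph V E) (x y : G.vertexSet) : ℕ :=
  {e : E | G.IsLink e x y}.ncard

theorem multiplicity_comm (G : Graph V E) (x y : G.vertexSet) :
    multiplicity G x y = multiplicity G y x := by
  simp only [multiplicity, Graph.isLink_comm]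

/-- The genus `|E(G)| - |V(G)| + 1` of a finite connected graph. -/
def genus (G : Graph V E) : ℕ := G.edgeSet.ncard + 1 - G.vertexSet.ncard

variable (G : Graph V E) [Fintype G.vertexSet]

/-- The degree homomorphism `Div(G) → ℤ`. -/
def degree : Divisor G →+ ℤ where
  toFun D := ∑ x, D x
  map_zero' := by simp
  map_add' D D' := by simp [Finset.sum_add_distrib]

/-- The divisor with one chip at the vertex `u`. -/
def pt (u : G.vertexSet) : Divisor G := by
  classical exact Pi.single u 1

/-- The result of firing each vertex `y` exactly `f y` times, starting from the zero divisor: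
each firing of `y` sends one chip from `y` along every edge incident to `y`. -/
def fire : Divisor G →+ Divisor G where
  toFun f := fun x => ∑ y, (multiplicity G x y : ℤ) * (f y - f x)
  map_zero' := by ext x; simp
  map_add' f f' := by
    ext x
    simp only [Pi.add_apply, ← Finset.sum_add_distrib]
    exact Finset.sum_congr rfl fun y _ => by ring

/-- The group of principal divisors. -/
def principal : AddSubgroup (Divisor G) := (fire G).range

/-- The Picard group: divisors modulo linear equivalence. -/
abbrev Pic : Type _ := Divisor G ⧸ principal G

/-- The Jacobian: the group of classes of divisors of degree zero. -/
def Jac : AddSubgroup (Pic G) :=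
  (degree G).ker.map (QuotientAddGroup.mk' (principal G))

theorem degree_pt (u : G.vertexSet) : degree G (pt G u) = 1 := by
  simp [degree, pt]

/-- The class `[u - v]` in the Jacobian. -/
def jacClass (u v : G.vertexSet) : Jac G :=
  ⟨QuotientAddGroup.mk' (principal G) (pt G u - pt G v),
    AddSubgroup.mem_map_of_mem _ (by
      rw [AddMonoidHom.mem_ker, map_sub, degree_pt, degree_pt, sub_self])⟩

/-- Linear equivalence of divisors. -/
def LinEquiv (D D' : Divisor G) : Prop := D - D' ∈ principal G

/-- The divisor `D` is linearly equivalent to an effective divisor, i.e. `|D|` is non-empty. -/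
def HasEffective (D : Divisor G) : Prop := ∃ F : Divisor G, 0 ≤ F ∧ LinEquiv G D F

/-- The integers `r ≥ -1` such that `|D - F|` is non-empty for every effective `F` of degree `r`
(for `r = -1` this is no condition). -/
def rankSet (D : Divisor G) : Set ℤ :=
  {r | -1 ≤ r ∧ ∀ F : Divisor G, 0 ≤ F → degree G F = r → HasEffective G (D - F)}

/-- The Baker-Norine rank `r(D)`: the largest element of `rankSet G D`. In particular `r(D) = -1`
exactly when `|D|` is empty. -/
def rank (D : Divisor G) : ℤ := sSup (rankSet G D)

theorem degree_fire (f : Divisor G) : degree G (fire G f) = 0 := by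
  have h : degree G (fire G f)
      = ∑ x, ∑ y, (multiplicity G x y : ℤ) * f y - ∑ x, ∑ y, (multiplicity G x y : ℤ) * f x := by
    simp [degree, fire, mul_sub, Finset.sum_sub_distrib]
  rw [h, Finset.sum_comm, sub_eq_zero]
  exact Finset.sum_congr rfl fun y _ => Finset.sum_congr rfl fun x _ => by
    rw [multiplicity_comm]

/-- On a non-empty graph the supremum in the definition of the rank is a maximum. -/
theorem rank_isGreatest [Nonempty G.vertexSet] (D : Divisor G) :
    IsGreatest (rankSet G D) (rank G D) := by
  have hne : (rankSet G D).Nonempty := by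
    refine ⟨-1, le_refl _, fun F hF hd => ?_⟩
    have : 0 ≤ degree G F := Finset.sum_nonneg fun x _ => hF x
    omega
  have hbd : BddAbove (rankSet G D) := by
    refine ⟨max (-1) (degree G D), fun r hr => ?_⟩
    rcases lt_or_ge r 0 with h0 | h0
    · exact le_max_of_le_left (by omega)
    · refine le_max_of_le_right ?_
      obtain ⟨x⟩ := ‹Nonempty G.vertexSet›
      have hpt : (0 : Divisor G) ≤ pt G x := by
        classical
        unfold pt
        exact Pi.single_nonneg.2 Int.one_nonneg
      obtain ⟨F, hF, g, hg⟩ := hr.2 (r • pt G x) (smul_nonneg h0 hpt) (by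
        rw [map_zsmul, degree_pt]; simp)
      have h1 : 0 ≤ degree G F := Finset.sum_nonneg fun x _ => hF x
      have h2 := congrArg (degree G) hg
      rw [degree_fire, map_sub, map_sub, map_zsmul, degree_pt] at h2
      simp at h2
      omega
  exact ⟨Int.csSup_mem hne hbd, fun r hr => le_csSup hbd hr⟩

variable (u v : G.vertexSet)

/-- `Δ(D) = r(D) - r(D - u) - r(D - v) + r(D - u - v)`. -/
def delta (D : Divisor G) : ℤ :=
  rank G D - rank G (D - pt G u) - rank G (D - pt G v) + rank G (D - pt G u - pt G v)

/-- `D` is submodular with respect to `u` and `v`: `Δ ≥ 0` for all twists `D + a u + b v`. -/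
def Submodular (D : Divisor G) : Prop :=
  ∀ a b : ℤ, 0 ≤ delta G u v (D + a • pt G u + b • pt G v)

/-- The bijection `τ : ℤ → ℤ` is the transmission permutation of `D`: for all integers `a, b`,
`Δ(D + a u - b v)` is `1` if `τ b = a` and `0` otherwise. (Clearly there is at most one.) -/
def IsTransmissionPerm (D : Divisor G) (τ : Equiv.Perm ℤ) : Prop :=
  ∀ a b : ℤ, delta G u v (D + a • pt G u - b • pt G v) = if τ b = a then 1 else 0

end Divisors

/-- The inversions of a permutation `τ` of `ℤ`: pairs `a < b` with `τ a > τ b`. -/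
def Inversion (τ : Equiv.Perm ℤ) : Type := {p : ℤ × ℤ // p.1 < p.2 ∧ τ p.1 > τ p.2}

/-- Two inversions `(a, b)` and `(a', b')` are `k`-equivalent if `a - a' = b - b'` and this
difference is divisible by `k`. -/
def inversionSetoid (k : ℕ) (τ : Equiv.Perm ℤ) : Setoid (Inversion τ) where
  r p q := p.1.1 - q.1.1 = p.1.2 - q.1.2 ∧ (k : ℤ) ∣ p.1.1 - q.1.1
  iseqv :=
    { refl := fun p => by simp
      symm := fun {p q} h => ⟨by linarith [h.1], (dvd_sub_comm).1 h.2⟩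
      trans := fun {p q s} h h' => ⟨by linarith [h.1, h'.1], by
        have := dvd_add h.2 h'.2
        rwa [sub_add_sub_cancel] at this⟩ }

/-- The number `inv_k(τ)` of `k`-equivalence classes of inversions (possibly infinite). -/
def invCount (k : ℕ) (τ : Equiv.Perm ℤ) : ℕ∞ := ENat.card (Quotient (inversionSetoid k τ))

/-- `(G, u, v)` has `k`-general transmission (`k` a positive integer): `k u ∼ k v`, and every
divisor `D` is submodular, with a transmission permutation `τ` satisfying `inv_k(τ) ≤ g`,
where `g` is the genus of `G`. -/
def HasGeneralTransmission {V E : Type*} (G : Graph V E) [Fintype G.vertexSet]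
    (u v : G.vertexSet) (k : ℕ) : Prop :=
  0 < k ∧ LinEquiv G (k • pt G u) (k • pt G v) ∧
    ∀ D : Divisor G, Submodular G u v D ∧
      ∃ τ : Equiv.Perm ℤ, IsTransmissionPerm G u v D τ ∧ invCount k τ ≤ (genus G : ℕ∞)

section Banana

variable {m : ℕ} (n : Fin m → ℕ)

/-- The vertices of the graph made of `m` paths of lengths `n 0, n 1, …` with common end points:
the end points `Sum.inl 0` and `Sum.inl 1`, and the `n α - 1` interior vertices of the path `α`,
for each `α`. -/
abbrev BananaVertex : Type := Fin 2 ⊕ (Σ α : Fin m, Fin (n α - 1))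

/-- The vertex at distance `i` from the first end point along the path `α` (for `0 ≤ i ≤ n α`). -/
def bananaLabel (α : Fin m) (i : ℕ) : BananaVertex n :=
  if i = 0 then Sum.inl 0
  else if h : i - 1 < n α - 1 then Sum.inr ⟨α, ⟨i - 1, h⟩⟩
  else Sum.inl 1

/-- The banana graph: two vertices joined by `m` internally disjoint paths of (positive) lengths
`n 0, n 1, …`. Its edges are the pairs `(α, i)` with `i < n α`, and `(α, i)` joins the `i`-th and
the `(i + 1)`-st vertex of the path `α`. -/
def bananaGraph : Graph (BananaVertex n) (Σ α : Fin m, Fin (n α)) where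
  vertexSet := Set.univ
  IsLink e x y := s(x, y) = s(bananaLabel n e.1 e.2, bananaLabel n e.1 (e.2 + 1))
  isLink_symm := fun e _ => ⟨fun x y h => by rw [Sym2.eq_swap]; exact h⟩
  eq_or_eq_of_isLink_of_isLink := fun e x y v w h h' => by
    have h2 := h.trans h'.symm
    rw [Sym2.eq_iff] at h2
    tauto
  left_mem_of_isLink := fun _ _ _ _ => Set.mem_univ _

instance : Fintype (bananaGraph n).vertexSet :=
  inferInstanceAs (Fintype (Set.univ : Set (BananaVertex n)))

/-- The vertex `v_{α,i}` of the banana graph, at distance `i` along the strand `α`. -/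
def strandVertex (α : Fin m) (i : ℕ) : (bananaGraph n).vertexSet :=
  ⟨bananaLabel n α i, Set.mem_univ _⟩

end Banana

/-- The theta graph `θ_{n 0, n 1, n 2}`. -/
abbrev thetaGraph (n : Fin 3 → ℕ) : Graph (BananaVertex n) (Σ α : Fin 3, Fin (n α)) :=
  bananaGraph n

/-- The vertex `x` of the theta graph lies in the interior of the strand `α`. -/
def InStrandInterior (n : Fin 3 → ℕ) (α : Fin 3) (x : (thetaGraph n).vertexSet) : Prop :=
  ∃ i : ℕ, 0 < i ∧ i < n α ∧ x = strandVertex n α i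

/-- The theta graph with marked vertices `v_{α,i}` and `v_{β,j}` is evenly marked. -/
def EvenlyMarked (n : Fin 3 → ℕ) (α : Fin 3) (i : ℕ) (β : Fin 3) (j : ℕ) : Prop :=
  α ≠ β ∧ 0 < i ∧ i < n α ∧ (i : ℚ) / (n α : ℚ) = (j : ℚ) / (n β : ℚ)

end

end ChipFiring

/-! The Jacobian of the theta graph is `ℤ³` modulo `jacLattice`, where `e_γ` is one step along the
strand `γ`. A divisor is principal exactly when its degree and its `weight` vanish
(`mem_principal_iff`), so questions about equivalence of points become small problems of integer
arithmetic. They give genus-two Riemann-Roch in the form needed here: every class of degree two is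
effective, exactly one class of degree two has rank one (the sum `K` of the two end points), and the
rank is `degree - 2` from degree three on.

Submodularity (`delta_nonneg`) can fail only in degrees one to three. In degrees one and three a
failure forces `u ∼ v`. In degree two it gives `D ∼ u + x ∼ v + y`, and `exchange` yields `x = v` or
`D ∼ K`; neither is compatible with a failure.

Submodularity makes the array of ranks of the twists `D + xu - yv` count the points of a permutation
`τ` (`exists_perm_of_submodular`). The rectangle spanned by an inversion of `τ` contains a twist of
degree one and rank zero, hence a vertex `w`, and that twist determines the inversion. All these
twists lie in one coset of `⟨[u - v]⟩`. For even marking such a coset contains at most two vertices.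
Two inversions with the same vertex differ by a multiple of the order `k`, so there are at most `2 =
g` classes. -/

namespace ChipFiring

/-! ### Linear equivalence and the Baker-Norine rank on an arbitrary graph. -/

section Rank

variable {V E : Type*} {G : Graph V E}

theorem pt_nonneg (x : G.vertexSet) : (0 : Divisor G) ≤ pt G x := by
  classical
  unfold pt
  exact Pi.single_nonneg.2 Int.one_nonneg

variable [Fintype G.vertexSet]

theorem degree_nonneg {F : Divisor G} (hF : 0 ≤ F) : 0 ≤ degree G F :=
  Finset.sum_nonneg fun x _ => hF x

theorem LinEquiv.refl (D : Divisor G) : LinEquiv G D D := by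
  simp [LinEquiv, zero_mem]

theorem LinEquiv.symm {D D' : Divisor G} (h : LinEquiv G D D') : LinEquiv G D' D := by
  have := neg_mem h
  rwa [neg_sub] at this

theorem LinEquiv.trans {D D' D'' : Divisor G} (h : LinEquiv G D D') (h' : LinEquiv G D' D'') :
    LinEquiv G D D'' := by
  have := add_mem h h'
  rwa [sub_add_sub_cancel] at this

theorem LinEquiv.sub_right {D D' : Divisor G} (h : LinEquiv G D D') (F : Divisor G) :
    LinEquiv G (D - F) (D' - F) := by
  unfold LinEquiv at *
  rwa [sub_sub_sub_cancel_right]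

theorem LinEquiv.degree_eq {D D' : Divisor G} (h : LinEquiv G D D') :
    degree G D = degree G D' := by
  obtain ⟨f, hf⟩ := h
  have := congrArg (degree G) hf
  rw [degree_fire, map_sub] at this
  omega

theorem HasEffective.congr {D D' : Divisor G} (h : LinEquiv G D D') (hD : HasEffective G D) :
    HasEffective G D' := by
  obtain ⟨F, hF, hDF⟩ := hD
  exact ⟨F, hF, h.symm.trans hDF⟩

theorem HasEffective.degree_nonneg {D : Divisor G} (hD : HasEffective G D) : 0 ≤ degree G D := by
  obtain ⟨F, hF, hDF⟩ := hD
  rw [hDF.degree_eq]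
  exact ChipFiring.degree_nonneg hF

theorem HasEffective.add {D F : Divisor G} (hD : HasEffective G D) (hF : 0 ≤ F) :
    HasEffective G (D + F) := by
  obtain ⟨F', hF', hDF⟩ := hD
  refine ⟨F' + F, add_nonneg hF' hF, ?_⟩
  unfold LinEquiv at *
  rwa [add_sub_add_right_eq_sub]

/-- An effective divisor of positive degree has a chip. -/
theorem exists_eq_pt_add {F : Divisor G} (hF : 0 ≤ F) (hd : 0 < degree G F) :
    ∃ (x : G.vertexSet) (F' : Divisor G), 0 ≤ F' ∧ F = pt G x + F' := by
  classical
  have : ∃ x, 0 < F x := by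
    by_contra! h
    have : degree G F ≤ 0 := Finset.sum_nonpos fun x _ => h x
    omega
  obtain ⟨x, hx⟩ := this
  refine ⟨x, F - pt G x, fun y => ?_, by abel⟩
  have hy : 0 ≤ F y := hF y
  by_cases h : y = x
  · subst h; simp [pt]; omega
  · simpa [pt, h] using hy

theorem eq_zero_of_degree_eq_zero {F : Divisor G} (hF : 0 ≤ F) (hd : degree G F = 0) : F = 0 := by
  funext x
  exact (Finset.sum_eq_zero_iff_of_nonneg fun x _ => hF x).1 hd x (Finset.mem_univ x)

theorem linEquiv_zero_of_hasEffective {D : Divisor G} (h : HasEffective G D)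
    (hd : degree G D = 0) : LinEquiv G D 0 := by
  obtain ⟨F, hF, hDF⟩ := h
  rw [hDF.degree_eq] at hd
  rwa [eq_zero_of_degree_eq_zero hF hd] at hDF

theorem exists_linEquiv_pt {D : Divisor G} (h : HasEffective G D) (hd : degree G D = 1) :
    ∃ x, LinEquiv G D (pt G x) := by
  obtain ⟨F, hF, hDF⟩ := h
  rw [hDF.degree_eq] at hd
  obtain ⟨x, F', hF', rfl⟩ := exists_eq_pt_add hF (by omega)
  rw [map_add, degree_pt] at hd
  rw [eq_zero_of_degree_eq_zero hF' (by omega), add_zero] at hDF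
  exact ⟨x, hDF⟩

variable [Nonempty G.vertexSet]

theorem neg_one_le_rank (D : Divisor G) : -1 ≤ rank G D := (rank_isGreatest G D).1.1

theorem le_rank {D : Divisor G} {r : ℤ} (hr : -1 ≤ r)
    (h : ∀ F : Divisor G, 0 ≤ F → degree G F = r → HasEffective G (D - F)) : r ≤ rank G D :=
  (rank_isGreatest G D).2 ⟨hr, h⟩

theorem exists_effective_degree {r : ℤ} (hr : 0 ≤ r) :
    ∃ F : Divisor G, 0 ≤ F ∧ degree G F = r := by
  obtain ⟨x⟩ := ‹Nonempty G.vertexSet›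
  exact ⟨r • pt G x, smul_nonneg hr (pt_nonneg x), by rw [map_zsmul, degree_pt]; simp⟩

/-- Pad `F` with an effective divisor up to degree `rank G D`, then add the padding back. -/
theorem hasEffective_sub {D F : Divisor G} (hF : 0 ≤ F) (h : degree G F ≤ rank G D) :
    HasEffective G (D - F) := by
  obtain ⟨F', hF', hd⟩ := exists_effective_degree (G := G) (sub_nonneg.2 h)
  have := (rank_isGreatest G D).1.2 (F + F') (add_nonneg hF hF') (by rw [map_add]; omega)
  have := this.add hF'
  rwa [← sub_sub, sub_add_cancel] at this

theorem hasEffective_of_rank {D : Divisor G} (h : 0 ≤ rank G D) : HasEffective G D := by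
  have := hasEffective_sub (D := D) (le_refl 0) (by simpa using h)
  rwa [sub_zero] at this

theorem rank_nonneg_iff {D : Divisor G} : 0 ≤ rank G D ↔ HasEffective G D := by
  refine ⟨hasEffective_of_rank, fun h => le_rank (by norm_num) fun F hF hd => ?_⟩
  rwa [eq_zero_of_degree_eq_zero hF hd, sub_zero]

theorem one_le_rank_iff {D : Divisor G} :
    1 ≤ rank G D ↔ ∀ x, HasEffective G (D - pt G x) := by
  refine ⟨fun h x => hasEffective_sub (pt_nonneg x) (by rwa [degree_pt]),
    fun h => le_rank (by norm_num) fun F hF hd => ?_⟩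
  obtain ⟨x, F', hF', rfl⟩ := exists_eq_pt_add hF (by omega)
  rw [map_add, degree_pt] at hd
  rw [eq_zero_of_degree_eq_zero hF' (by omega), add_zero]
  exact h x

theorem rank_congr {D D' : Divisor G} (h : LinEquiv G D D') : rank G D = rank G D' := by
  have key : ∀ {D D' : Divisor G}, LinEquiv G D D' → rank G D ≤ rank G D' := fun {D D'} h =>
    le_rank (neg_one_le_rank D) fun F hF hd => (hasEffective_sub hF hd.le).congr (h.sub_right F)
  exact le_antisymm (key h) (key h.symm)

theorem rank_le_degree {D : Divisor G} (h : -1 ≤ degree G D) : rank G D ≤ degree G D := by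
  by_contra! hlt
  obtain ⟨F, hF, hd⟩ := exists_effective_degree (G := G) (r := rank G D) (by omega)
  have := (hasEffective_sub hF hd.le).degree_nonneg
  rw [map_sub] at this
  omega

theorem rank_eq_neg_one {D : Divisor G} (h : degree G D < 0) : rank G D = -1 := by
  refine le_antisymm ?_ (neg_one_le_rank D)
  by_contra! hlt
  have := (hasEffective_of_rank (D := D) (by omega)).degree_nonneg
  omega

theorem rank_sub_pt_ge (D : Divisor G) (x : G.vertexSet) : rank G D - 1 ≤ rank G (D - pt G x) := by
  rcases lt_or_ge (rank G D) 0 with h | h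
  · have := neg_one_le_rank (D - pt G x)
    omega
  · refine le_rank (by omega) fun F hF hd => ?_
    rw [sub_sub]
    exact hasEffective_sub (add_nonneg (pt_nonneg x) hF) (by rw [map_add, degree_pt]; omega)

theorem rank_sub_pt_le (D : Divisor G) (x : G.vertexSet) : rank G (D - pt G x) ≤ rank G D := by
  refine le_rank (neg_one_le_rank _) fun F hF hd => ?_
  have := (hasEffective_sub hF hd.le).add (pt_nonneg x)
  rwa [sub_right_comm, sub_add_cancel] at this

end Rank

/-! ### Rank arrays on `ℤ × ℤ` and their permutations. -/

section RankArray

theorem monotone_of_pred_le {c : ℤ → ℤ} (hc : ∀ x, c (x - 1) ≤ c x) : Monotone c :=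
  monotone_int_of_le_succ fun x => by simpa using hc (x + 1)

/-- A monotone function on `ℤ` increasing from `0` to `1` is the indicator of a half-line. -/
theorem exists_eq_ite_le {c : ℤ → ℤ} (hc : ∀ x, c (x - 1) ≤ c x) {A B : ℤ}
    (hA : ∀ x < A, c x = 0) (hB : ∀ x, B ≤ x → c x = 1) :
    ∃ t, ∀ x, c x = if t ≤ x then 1 else 0 := by
  have hm := monotone_of_pred_le hc
  obtain ⟨t, ht, hmin⟩ := Int.exists_least_of_bdd (P := fun x => 1 ≤ c x)
    ⟨A, fun z hz => by by_contra! h; have := hA z h; omega⟩ ⟨B, (hB B le_rfl).ge⟩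
  refine ⟨t, fun x => ?_⟩
  split_ifs with h
  · have h1 := hm h
    have h2 := hm (le_max_left x B)
    have h3 := hB _ (le_max_right x B)
    omega
  · have h1 : c x < 1 := by by_contra! h'; exact h (hmin x h')
    have h2 := hm (min_le_left x (A - 1))
    have h3 := hA (min x (A - 1)) (by omega)
    omega

variable {R : ℤ → ℤ → ℤ} {d : ℤ}

/-- A submodular array of ranks on `ℤ × ℤ`, which is `-1` in negative degree and satisfies
Riemann-Roch for genus two in large degree, counts the points of a permutation. -/
theorem exists_perm_of_submodular (hneg : ∀ x y, x - y + d < 0 → R x y = -1)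
    (hlarge : ∀ x y, 3 ≤ x - y + d → R x y = x - y + d - 2)
    (hsub : ∀ x y, 0 ≤ R x y - R (x - 1) y - R x (y + 1) + R (x - 1) (y + 1)) :
    ∃ τ : Equiv.Perm ℤ, ∀ x y, R x y - R x (y + 1) = if τ y ≤ x then 1 else 0 := by
  -- Submodularity is monotonicity in `x` of this difference, which is `0` in low degree and `1` in
  -- high degree. The bound `y - d + 4` puts both terms in degree at least three.
  have hrow : ∀ y, ∃ t, ∀ x, R x y - R x (y + 1) = if t ≤ x then 1 else 0 := fun y =>
    exists_eq_ite_le (c := fun x => R x y - R x (y + 1)) (fun x => by linarith [hsub x y])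
      (A := y - d) (B := y - d + 4)
      (fun x hx => by rw [hneg _ _ (by omega), hneg _ _ (by omega)]; rfl)
      (fun x hx => by rw [hlarge _ _ (by omega), hlarge _ _ (by omega)]; ring)
  -- The sign of `y` is reversed so that the degree increases along the column.
  have hcol : ∀ x, ∃ t, ∀ y, R x (-y) - R (x - 1) (-y) = if t ≤ y then 1 else 0 := fun x =>
    exists_eq_ite_le (c := fun y => R x (-y) - R (x - 1) (-y))
      (fun y => by
        have := hsub x (-y)
        rw [show -y + 1 = -(y - 1) by ring] at this
        linarith)
      (A := - x - d) (B := - x - d + 4)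
      (fun y hy => by rw [hneg _ _ (by omega), hneg _ _ (by omega)]; rfl)
      (fun y hy => by rw [hlarge _ _ (by omega), hlarge _ _ (by omega)]; ring)
  choose f hf using hrow
  choose g hg using hcol
  -- Both conditions say that the mixed second difference of `R` at `(x, y)` is `1`; hence `f` and
  -- `-g` are mutually inverse.
  have key : ∀ x y, f y = x ↔ g x = -y := fun x y => by
    have h1 := hf y x
    have h2 := hf y (x - 1)
    have h3 := hg x (-y)
    have h4 := hg x (-y - 1)
    rw [neg_neg] at h3
    rw [show -(-y - 1) = y + 1 by ring] at h4
    split_ifs at h1 h2 h3 h4 <;> omega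
  exact ⟨⟨f, fun x => -g x, fun y => by simp [(key (f y) y).1 rfl],
    fun x => (key x _).2 (neg_neg _).symm⟩, fun x y => hf y x⟩

theorem delta_eq_ite {τ : Equiv.Perm ℤ}
    (hτ : ∀ x y, R x y - R x (y + 1) = if τ y ≤ x then 1 else 0) (x y : ℤ) :
    R x y - R (x - 1) y - R x (y + 1) + R (x - 1) (y + 1) = if τ y = x then 1 else 0 := by
  have h1 := hτ x y
  have h2 := hτ (x - 1) y
  split_ifs at h1 h2 ⊢ <;> omega

/-! ### Counting points of the permutation in quadrants; inversions and points of degree one. -/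

section Quadrants

variable {τ : Equiv.Perm ℤ} (hτ : ∀ x y, R x y - R x (y + 1) = if τ y ≤ x then 1 else 0)
include hτ

theorem rank_antitone (x : ℤ) : Antitone (R x) :=
  antitone_int_of_succ_le fun y => by
    have := hτ x y
    split_ifs at this <;> omega

theorem rank_add_monotone (x : ℤ) : Monotone fun y => R x y + y :=
  monotone_int_of_le_succ fun y => by
    have := hτ x y
    split_ifs at this <;> omega

/-- Going down from `q + 1` to `q`, the row gains one exactly when `τ q ≤ x`. So each `q ≥ y` with
`τ q ≤ x` raises `R x y` by one above the floor `-1`. -/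
theorem one_le_of_two_below (hR : ∀ x y, -1 ≤ R x y) {x y q q' : ℤ} (hq : y ≤ q) (hqq : q < q')
    (h : τ q ≤ x) (h' : τ q' ≤ x) : 1 ≤ R x y := by
  have h1 := hτ x q
  have h2 := hτ x q'
  rw [if_pos h] at h1
  rw [if_pos h'] at h2
  have h3 := rank_antitone hτ x hq
  have h4 := rank_antitone hτ x (show q + 1 ≤ q' by omega)
  have h5 := hR x (q' + 1)
  omega

theorem nonneg_of_below (hR : ∀ x y, -1 ≤ R x y) {x y q : ℤ} (hq : y ≤ q) (h : τ q ≤ x) :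
    0 ≤ R x y := by
  have h1 := hτ x q
  rw [if_pos h] at h1
  have h3 := rank_antitone hτ x hq
  have h5 := hR x (q + 1)
  omega

/-- The dual count: each `p < y` with `τ p > x` raises `R x y` by one above Riemann's bound `x - y +
d - 2`. -/
theorem degree_sub_one_le_of_above (hR : ∀ x y, x - y + d - 2 ≤ R x y) {x y p : ℤ} (hp : p < y)
    (h : x < τ p) : x - y + d - 1 ≤ R x y := by
  have h1 := hτ x p
  rw [if_neg (by omega)] at h1
  have h3 := rank_add_monotone hτ x (show p + 1 ≤ y by omega)
  have h5 := hR x p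
  simp only at h3
  omega

theorem degree_le_of_two_above (hR : ∀ x y, x - y + d - 2 ≤ R x y) {x y p p' : ℤ} (hp : p < y)
    (hpp : p' < p) (h : x < τ p) (h' : x < τ p') : x - y + d ≤ R x y := by
  have h1 := hτ x p
  have h2 := hτ x p'
  rw [if_neg (by omega)] at h1 h2
  have h3 := rank_add_monotone hτ x (show p + 1 ≤ y by omega)
  have h4 := rank_add_monotone hτ x (show p' + 1 ≤ p by omega)
  have h5 := hR x p'
  simp only at h3 h4
  omega

/-- `τ y` is the least `x` at which the row difference is `1`, so `τ` inherits the diagonal periods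
of `R`. -/
theorem apply_add_period {e : ℤ} (hper : ∀ x y, R (x + e) (y + e) = R x y) (y : ℤ) :
    τ (y + e) = τ y + e := by
  have key : ∀ x, τ (y + e) ≤ x + e ↔ τ y ≤ x := fun x => by
    have h1 := hτ x y
    have h2 := hτ (x + e) (y + e)
    rw [hper, show y + e + 1 = y + 1 + e by ring, hper] at h2
    split_ifs at h1 h2 <;> omega
  have h1 := (key (τ y)).2 le_rfl
  have h2 := (key (τ (y + e) - e)).1 (by omega)
  omega

/-- The rectangle of an inversion contains a point of degree one. -/
theorem exists_degree_one_row (hpos : ∀ x y, 0 ≤ R x y → 0 ≤ x - y + d)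
    (hlt : ∀ x y, 1 ≤ x - y + d → R x y < x - y + d)
    (hge : ∀ x y, x - y + d - 2 ≤ R x y)
    (hlarge : ∀ x y, 3 ≤ x - y + d → R x y = x - y + d - 2) (hbot : ∀ x y, -1 ≤ R x y)
    (hmono : ∀ x y, R (x - 1) y ≤ R x y ∧ R x y ≤ R (x - 1) y + 1)
    (hmark : ∀ x y, x - y + d = 0 → 0 ≤ R x y → R (x + 1) (y - 1) ≤ 0)
    {p q : ℤ} (hpq : p < q) (hinv : τ q < τ p) :
    ∃ y, p < y ∧ y ≤ q ∧ τ q ≤ y + 1 - d ∧ y + 1 - d < τ p := by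
  -- The corner `(τ q, q)` has the least degree in the rectangle, at least `0`; the corner `(τ p -
  -- 1, p + 1)` has the greatest, at most `2`. Degree one is missed only if the rectangle is a
  -- single point of degree `0` or of degree `2`.
  have hlow := nonneg_of_below hτ hbot (le_refl q) (le_refl (τ q))
  have hlow' := hpos _ _ hlow
  have hup := degree_sub_one_le_of_above hτ hge (show p < p + 1 by omega)
    (show τ p - 1 < τ p by omega)
  have hup' : τ p - 1 - (p + 1) + d ≤ 2 := by
    by_contra! h
    have := hlarge _ _ (show 3 ≤ τ p - 1 - (p + 1) + d by omega)
    omega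
  -- A single point of degree `0` would be the trivial class. The twist at `(τ p, p)` would then be
  -- `u + v`, and the second difference `1` there would need a rank above the bound `hmark`.
  have h1 : τ p - 1 - (p + 1) + d ≠ 0 := fun h => by
    obtain rfl : q = p + 1 := by omega
    have hτp : τ p = τ (p + 1) + 1 := by omega
    have hd := delta_eq_ite hτ (τ p) p
    rw [if_pos rfl] at hd
    have h2 := hmark (τ (p + 1)) (p + 1) (by omega) hlow
    rw [← hτp, add_sub_cancel_right] at h2
    rw [show τ (p + 1) = τ p - 1 by omega] at hlow
    have h3 := rank_antitone hτ (τ p - 1) (show p ≤ p + 1 by omega)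
    have h4 := hmono (τ p) (p + 1)
    omega
  -- A single point of degree `2` would have rank one. The second difference `1` at `(τ q, q)` then
  -- makes the twist at `(τ q - 1, q + 1)` trivial, against `hmark` again.
  have h2 : τ q - q + d ≠ 2 := fun h => by
    obtain rfl : p = q - 1 := by omega
    have hτp : τ (q - 1) = τ q + 1 := by omega
    rw [hτp, add_sub_cancel_right, sub_add_cancel] at hup
    have hd := delta_eq_ite hτ (τ q) q
    rw [if_pos rfl] at hd
    have h3 := hmono (τ q) q
    have h4 := hτ (τ q) q
    rw [if_pos le_rfl] at h4
    have h5 := hlt (τ q) q (by omega)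
    have h6 := hmark (τ q - 1) (q + 1) (by omega) (by omega)
    rw [sub_add_cancel, add_sub_cancel_right] at h6
    omega
  -- The least `y` for which `(y + 1 - d, y)`, on the line of degree one, satisfies the lower bounds
  -- `p < y` and `τ q ≤ x`.
  refine ⟨max (p + 1) (τ q + d - 1), ?_, ?_, ?_, ?_⟩ <;> omega

/-- An inversion is determined by a point of degree one in its rectangle. -/
theorem inversion_unique (hlt : ∀ x y, 1 ≤ x - y + d → R x y < x - y + d)
    (hge : ∀ x y, x - y + d - 2 ≤ R x y) (hbot : ∀ x y, -1 ≤ R x y) {x y p q p' q' : ℤ}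
    (hxy : x - y + d = 1) (hp : p < y) (hq : y ≤ q) (hq' : τ q ≤ x) (hp' : x < τ p)
    (hpp : p' < y) (hqq : y ≤ q') (hqq' : τ q' ≤ x) (hpp' : x < τ p') : p = p' ∧ q = q' := by
  -- In degree one the rank is at most `0`, while two points in either quadrant would make it at
  -- least `1`.
  have h := hlt x y (by omega)
  constructor
  · rcases lt_trichotomy p p' with h1 | h1 | h1
    · have := degree_le_of_two_above hτ hge hpp h1 hpp' hp'
      omega
    · exact h1
    · have := degree_le_of_two_above hτ hge hp h1 hp' hpp'
      omega
  · rcases lt_trichotomy q q' with h1 | h1 | h1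
    · have := one_le_of_two_below hτ hbot hq h1 hq' hqq'
      omega
    · exact h1
    · have := one_le_of_two_below hτ hbot hqq h1 hqq' hq'
      omega

end Quadrants

end RankArray

/-! ### Firing as a sum over edges. -/

section Edges

variable {V E : Type*} (G : Graph V E)

theorem pt_apply [DecidableEq G.vertexSet] (u x : G.vertexSet) :
    pt G u x = if x = u then 1 else 0 := by
  unfold pt
  by_cases h : x = u
  · subst h; simp
  · simp [h]

variable [Fintype G.vertexSet]

theorem sum_smul_pt (D : Divisor G) : ∑ x, D x • pt G x = D := by
  classical
  funext y
  simp [Finset.sum_apply, pt_apply]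

/-- Firing in terms of the edges of the graph. -/
theorem fire_eq_sum_edges [Fintype E] (s t : E → G.vertexSet)
    (hst : ∀ e (x y : G.vertexSet), G.IsLink e x y ↔ s(x, y) = s(s e, t e)) (f : Divisor G) :
    fire G f = ∑ e, (f (t e) - f (s e)) • (pt G (s e) - pt G (t e)) := by
  classical
  funext x
  have hm : ∀ y, (multiplicity G x y : ℤ) = ∑ e, if s(x, y) = s(s e, t e) then 1 else 0 :=
    fun y => by
      rw [multiplicity, Set.ncard_eq_toFinset_card', Finset.card_eq_sum_ones, Finset.sum_boole]
      simp [← hst]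
  simp only [fire, AddMonoidHom.coe_mk, ZeroHom.coe_mk, hm, Finset.sum_mul]
  rw [Finset.sum_comm, Finset.sum_apply]
  refine Finset.sum_congr rfl fun e _ => ?_
  simp only [Pi.smul_apply, Pi.sub_apply, pt_apply, smul_eq_mul, ite_mul, one_mul, zero_mul]
  generalize s e = a
  generalize t e = b
  by_cases ha : x = a
  · subst ha
    by_cases hb : x = b
    · subst hb
      simp
    · have : ∀ y, s(x, y) = s(x, b) ↔ y = b := fun y => by simp; grind
      simp [this, hb]
  · by_cases hb : x = b
    · subst hb
      have : ∀ y, s(x, y) = s(a, x) ↔ y = a := fun y => by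
        rw [Sym2.eq_swap (a := a)]; simp; grind
      simp [this, ha]
    · have : ∀ y, s(x, y) ≠ s(a, b) := fun y h => by
        rcases Sym2.eq_iff.1 h with h | h
        · exact ha h.1
        · exact hb h.1
      simp [this, ha, hb]

end Edges

/-! ### Vertices of the theta graph as points of strands. -/

section Strands

variable {n : Fin 3 → ℕ}

theorem exists_eq_strandVertex (hn : ∀ γ, 0 < n γ) (x : (thetaGraph n).vertexSet) :
    ∃ (γ : Fin 3) (t : ℕ), t ≤ n γ ∧ x = strandVertex n γ t := by
  obtain ⟨x, hx⟩ := x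
  rcases x with x | ⟨γ, t⟩
  · fin_cases x
    · exact ⟨0, 0, Nat.zero_le _, Subtype.ext (by simp [strandVertex, bananaLabel])⟩
    · refine ⟨0, n 0, le_rfl, Subtype.ext ?_⟩
      have := hn 0
      simp [strandVertex, bananaLabel]
      omega
  · refine ⟨γ, t + 1, by omega, Subtype.ext ?_⟩
    simp [strandVertex, bananaLabel]

theorem strandVertex_zero (γ δ : Fin 3) : strandVertex n γ 0 = strandVertex n δ 0 :=
  Subtype.ext (by simp [strandVertex, bananaLabel])

theorem strandVertex_last (hn : ∀ γ, 0 < n γ) (γ δ : Fin 3) :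
    strandVertex n γ (n γ) = strandVertex n δ (n δ) := by
  have := (hn γ).ne'
  have := (hn δ).ne'
  exact Subtype.ext (by simp [strandVertex, bananaLabel, *])

/-- No bound on `s` is needed: positions past the end are labelled by the second end point, which is
not interior. -/
theorem strandVertex_eq_iff {γ δ : Fin 3} {s t : ℕ} (ht : 0 < t) (htn : t < n δ) :
    strandVertex n γ s = strandVertex n δ t ↔ γ = δ ∧ s = t := by
  have h1 : ¬ t = 0 := by omega
  have h2 : t - 1 < n δ - 1 := by omega
  refine ⟨fun h => ?_, fun h => by rw [h.1, h.2]⟩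
  have h := congrArg Subtype.val h
  simp only [strandVertex, bananaLabel, dif_pos h2, if_neg h1] at h
  split_ifs at h with h3 h4
  have h := Sum.inr.inj h
  rw [Sigma.mk.injEq] at h
  obtain ⟨rfl, h⟩ := h
  have := congrArg Fin.val (eq_of_heq h)
  simp only at this
  exact ⟨rfl, by omega⟩

theorem strandVertex_eq_zero_iff {γ δ : Fin 3} {s : ℕ} :
    strandVertex n γ s = strandVertex n δ 0 ↔ s = 0 := by
  refine ⟨fun h => ?_, fun h => by rw [h]; exact strandVertex_zero _ _⟩
  have h := congrArg Subtype.val h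
  simp only [strandVertex, bananaLabel, if_true] at h
  split_ifs at h with h3 h4
  · exact h3
  · simp at h

theorem fire_theta (f : Divisor (thetaGraph n)) :
    fire (thetaGraph n) f = ∑ γ : Fin 3, ∑ t : Fin (n γ),
      (f (strandVertex n γ (t + 1)) - f (strandVertex n γ t)) •
        (pt (thetaGraph n) (strandVertex n γ t) - pt (thetaGraph n) (strandVertex n γ (t + 1))) := by
  rw [fire_eq_sum_edges (thetaGraph n) (fun e => strandVertex n e.1 e.2)
    (fun e => strandVertex n e.1 (e.2 + 1)), Fintype.sum_sigma]
  rintro e ⟨x, hx⟩ ⟨y, hy⟩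
  change s(x, y) = s(_, _) ↔ _
  simp [strandVertex, Subtype.ext_iff]

end Strands

/-! ### Homomorphisms on divisors, and the presentation of the Jacobian by `jacLattice`. -/

section Combination

variable {ι A : Type*} [Fintype ι] [AddCommGroup A]

/-- The homomorphism `m ↦ ∑ i, m i • w i`. -/
def combination (w : ι → A) : (ι → ℤ) →+ A where
  toFun m := ∑ i, m i • w i
  map_zero' := by simp
  map_add' m m' := by simp only [Pi.add_apply, add_smul, Finset.sum_add_distrib]

theorem combination_single [DecidableEq ι] (w : ι → A) (i : ι) (c : ℤ) :
    combination w (Pi.single i c) = c • w i := by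
  simp [combination, Pi.single_apply]

theorem combination_pt {V E : Type*} (G : Graph V E) [Fintype G.vertexSet] (w : G.vertexSet → A)
    (x : G.vertexSet) : combination w (pt G x) = w x := by
  classical
  simp [combination, pt_apply]

theorem hom_ext_pt {V E : Type*} {G : Graph V E} [Fintype G.vertexSet] {φ ψ : Divisor G →+ A}
    (h : ∀ x, φ (pt G x) = ψ (pt G x)) : φ = ψ := by
  ext D
  rw [← sum_smul_pt G D]
  simp only [map_sum, map_zsmul, h]

end Combination

section Weight

variable (n : Fin 3 → ℕ)

/-- The lattice in `ℤ³` presenting the Jacobian of the theta graph, where the coordinate vector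
`e_γ` stands for a step along the strand `γ`. -/
def jacLattice : AddSubgroup (Fin 3 → ℤ) where
  carrier := {m | ∃ (F : ℤ) (s : Fin 3 → ℤ), ∑ γ, s γ = 0 ∧ ∀ γ, m γ = F - n γ * s γ}
  zero_mem' := ⟨0, 0, by simp, by simp⟩
  add_mem' := by
    rintro m m' ⟨F, s, hs, hm⟩ ⟨F', s', hs', hm'⟩
    exact ⟨F + F', s + s', by simp [Finset.sum_add_distrib, hs, hs'],
      fun γ => by simp only [Pi.add_apply, hm, hm']; ring⟩
  neg_mem' := by
    rintro m ⟨F, s, hs, hm⟩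
    exact ⟨-F, -s, by simp [hs], fun γ => by simp only [Pi.neg_apply, hm]; ring⟩

/-- The number of steps from the first end point to a vertex. -/
def vertexWeight : (thetaGraph n).vertexSet → Fin 3 → ℤ := fun x =>
  Sum.elim (fun z : Fin 2 => if z = 0 then 0 else Pi.single 0 (n 0 : ℤ))
    (fun p : Σ γ : Fin 3, Fin (n γ - 1) => Pi.single p.1 ((p.2 : ℕ) + 1 : ℤ)) x.1

/-- The weight of a divisor: the sum of its chips, in coordinates of the Jacobian based at the
first end point. -/
def weight : Divisor (thetaGraph n) →+ (Fin 3 → ℤ) ⧸ jacLattice n :=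
  combination fun x => QuotientAddGroup.mk' (jacLattice n) (vertexWeight n x)

variable {n}

theorem weight_pt (x : (thetaGraph n).vertexSet) :
    weight n (pt (thetaGraph n) x) = QuotientAddGroup.mk' (jacLattice n) (vertexWeight n x) :=
  combination_pt _ _ x

/-- The two hypotheses are the relations in the Picard group: firing the first end point, and the
common second end point of the strands. The lattice contains nothing beyond their consequences, so
`combination g` descends to the quotient. -/
theorem combination_eq_zero {A : Type*} [AddCommGroup A] {g : Fin 3 → A} {h : A}
    (hg : ∑ γ, g γ = 0) (hh : ∀ γ, (n γ : ℤ) • g γ = h) {m : Fin 3 → ℤ} (hm : m ∈ jacLattice n) :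
    combination g m = 0 := by
  obtain ⟨F, s, hs, hm⟩ := hm
  change ∑ γ, m γ • g γ = 0
  have h1 : ∀ γ, m γ • g γ = F • g γ - s γ • h := fun γ => by
    rw [hm, ← hh γ]; module
  simp only [h1, Finset.sum_sub_distrib, ← Finset.smul_sum, ← Finset.sum_smul, hg, hs]
  simp

theorem single_last_sub_mem (γ δ : Fin 3) :
    Pi.single γ (n γ : ℤ) - Pi.single δ (n δ : ℤ) ∈ jacLattice n := by
  refine ⟨0, Pi.single δ 1 - Pi.single γ 1, by simp [Finset.sum_sub_distrib], fun ε => ?_⟩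
  simp only [Pi.sub_apply, Pi.single_apply]
  split_ifs <;> subst_vars <;> simp

/-- The second end point was given coordinates along strand `0`; this choice is immaterial because
all `n_γ e_γ` agree modulo the lattice. -/
theorem weight_strandVertex {γ : Fin 3} {t : ℕ} (ht : t ≤ n γ) :
    weight n (pt (thetaGraph n) (strandVertex n γ t)) =
      QuotientAddGroup.mk' (jacLattice n) (Pi.single γ (t : ℤ)) := by
  rw [weight_pt]
  unfold vertexWeight strandVertex bananaLabel
  split_ifs with h h'
  · simp [h]
  · congr 1
    simp only [Sum.elim_inr]
    congr 1
    omega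
  · obtain rfl : t = n γ := by omega
    simp only [Sum.elim_inl, if_neg (show ¬ (1 : Fin 2) = 0 by decide)]
    rw [QuotientAddGroup.mk'_apply, QuotientAddGroup.mk'_apply, QuotientAddGroup.eq,
      neg_add_eq_sub]
    exact single_last_sub_mem γ 0

/-- Along each strand the firing differences telescope to the same number, so the weight is a
multiple of `(1, 1, 1)`, which lies in the lattice (`F = 1`, `s = 0`). -/
theorem weight_fire (hn : ∀ γ, 0 < n γ) (f : Divisor (thetaGraph n)) :
    weight n (fire (thetaGraph n) f) = 0 := by
  have hstep : ∀ γ : Fin 3, ∀ t : Fin (n γ),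
      weight n (pt (thetaGraph n) (strandVertex n γ t)
        - pt (thetaGraph n) (strandVertex n γ (t + 1))) =
      - QuotientAddGroup.mk' (jacLattice n) (Pi.single γ 1) := fun γ t => by
    rw [map_sub, weight_strandVertex t.2.le, weight_strandVertex t.2, ← map_sub, ← map_neg,
      ← Pi.single_sub, ← Pi.single_neg]
    push_cast
    congr 2
    ring
  simp only [fire_theta, map_sum, map_zsmul, hstep, ← Finset.sum_smul]
  have htel : ∀ γ, ∑ t : Fin (n γ), (f (strandVertex n γ (t + 1)) - f (strandVertex n γ t)) =
      f (strandVertex n 0 (n 0)) - f (strandVertex n 0 0) := fun γ => by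
    rw [Fin.sum_univ_eq_sum_range
      (fun t => f (strandVertex n γ (t + 1)) - f (strandVertex n γ t)) (n γ),
      Finset.sum_range_sub (fun t => f (strandVertex n γ t)),
      strandVertex_last hn γ 0, strandVertex_zero γ 0]
  simp only [htel]
  rw [← Finset.smul_sum, Finset.sum_neg_distrib, ← map_sum]
  have : QuotientAddGroup.mk' (jacLattice n) (∑ γ : Fin 3, Pi.single γ 1) = 0 :=
    (QuotientAddGroup.eq_zero_iff _).2 ⟨1, 0, by simp, fun γ => by
      simp [Finset.sum_apply, Pi.single_apply]⟩
  rw [this, neg_zero, smul_zero]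

theorem pt_sub_pt_mem {γ : Fin 3} {t : ℕ} (ht : t + 1 < n γ) :
    (pt (thetaGraph n) (strandVertex n γ t) - pt (thetaGraph n) (strandVertex n γ (t + 1)))
      - (pt (thetaGraph n) (strandVertex n γ (t + 1))
        - pt (thetaGraph n) (strandVertex n γ (t + 2))) ∈ principal (thetaGraph n) := by
  classical
  -- Fire the interior vertex between the two steps.
  refine ⟨pt (thetaGraph n) (strandVertex n γ (t + 1)), ?_⟩
  rw [fire_theta]
  simp only [pt_apply, strandVertex_eq_iff (Nat.succ_pos t) ht]
  rw [Finset.sum_eq_single_of_mem γ (Finset.mem_univ γ)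
    (fun δ _ hδ => Finset.sum_eq_zero fun s _ => by simp [hδ])]
  rw [Fin.sum_univ_eq_sum_range (fun s => ((if γ = γ ∧ s + 1 = t + 1 then (1 : ℤ) else 0)
    - if γ = γ ∧ s = t + 1 then 1 else 0) • (pt (thetaGraph n) (strandVertex n γ s)
        - pt (thetaGraph n) (strandVertex n γ (s + 1)))) (n γ)]
  simp [sub_smul, Finset.sum_sub_distrib, ite_smul, ht, show t < n γ by omega]

theorem sum_pt_sub_pt_mem (hn : ∀ γ, 0 < n γ) :
    ∑ γ, (pt (thetaGraph n) (strandVertex n γ 1) - pt (thetaGraph n) (strandVertex n γ 0))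
      ∈ principal (thetaGraph n) := by
  classical
  refine ⟨pt (thetaGraph n) (strandVertex n 0 0), ?_⟩
  rw [fire_theta]
  refine Finset.sum_congr rfl fun γ _ => ?_
  simp only [pt_apply, strandVertex_eq_zero_iff]
  rw [Fin.sum_univ_eq_sum_range (fun s => ((if s + 1 = 0 then (1 : ℤ) else 0)
    - if s = 0 then 1 else 0) • (pt (thetaGraph n) (strandVertex n γ s)
        - pt (thetaGraph n) (strandVertex n γ (s + 1)))) (n γ)]
  simp [ite_smul, hn γ]

/-- In the Picard group, the points of a strand are in arithmetic progression. -/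
theorem mk_strandVertex {γ : Fin 3} {t : ℕ} (ht : t ≤ n γ) :
    QuotientAddGroup.mk' (principal (thetaGraph n)) (pt (thetaGraph n) (strandVertex n γ t)) =
    QuotientAddGroup.mk' (principal (thetaGraph n)) (pt (thetaGraph n) (strandVertex n 0 0)) +
      (t : ℤ) • QuotientAddGroup.mk' (principal (thetaGraph n))
        (pt (thetaGraph n) (strandVertex n γ 1) - pt (thetaGraph n) (strandVertex n γ 0)) := by
  induction t using Nat.twoStepInduction with
  | zero => rw [strandVertex_zero γ 0]; simp
  | one => rw [strandVertex_zero γ 0]; simp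
  | more t h0 h1 =>
    have h := (QuotientAddGroup.eq_zero_iff _).2 (pt_sub_pt_mem (n := n) (γ := γ) (t := t) ht)
    rw [← QuotientAddGroup.mk'_apply] at h
    have h0 := h0 (by omega)
    have h1 := h1 (by omega)
    set g := QuotientAddGroup.mk' (principal (thetaGraph n))
        (pt (thetaGraph n) (strandVertex n γ 1) - pt (thetaGraph n) (strandVertex n γ 0))
    rw [map_sub, map_sub, map_sub, h0, h1] at h
    rw [← sub_eq_zero, ← h]
    push_cast
    module

/-- The presentation of the Jacobian of the theta graph. -/
theorem mem_principal_iff (hn : ∀ γ, 0 < n γ) {D : Divisor (thetaGraph n)} :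
    D ∈ principal (thetaGraph n) ↔ degree (thetaGraph n) D = 0 ∧ weight n D = 0 := by
  constructor
  · rintro ⟨f, rfl⟩
    exact ⟨degree_fire _ f, weight_fire hn f⟩
  rintro ⟨hd, hw⟩
  set π := QuotientAddGroup.mk' (principal (thetaGraph n)) with hπ
  set g : Fin 3 → Pic (thetaGraph n) := fun γ =>
    π (pt (thetaGraph n) (strandVertex n γ 1) - pt (thetaGraph n) (strandVertex n γ 0)) with hg
  have hlast : ∀ γ, (n γ : ℤ) • g γ = (n 0 : ℤ) • g 0 := fun γ => by
    have h := congrArg (fun x => π (pt (thetaGraph n) x)) (strandVertex_last hn γ 0)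
    rwa [hπ, mk_strandVertex le_rfl, mk_strandVertex le_rfl, add_right_inj] at h
  have h2 : ∑ γ, g γ = 0 := by
    rw [hg, ← map_sum]
    exact (QuotientAddGroup.eq_zero_iff _).2 (sum_pt_sub_pt_mem hn)
  let ψ := QuotientAddGroup.lift (jacLattice n) (combination g)
    fun m hm => combination_eq_zero h2 hlast hm
  have hpt : ∀ x, π (pt (thetaGraph n) x) = π (pt (thetaGraph n) (strandVertex n 0 0))
      + ψ (weight n (pt (thetaGraph n) x)) := fun x => by
    obtain ⟨γ, t, ht, rfl⟩ := exists_eq_strandVertex hn x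
    rw [weight_strandVertex ht, hπ, mk_strandVertex ht]
    congr 1
    exact (combination_single g γ (t : ℤ)).symm
  -- The class of a divisor is thus recovered from its degree and weight; it suffices to check this
  -- on points.
  have : π = (zmultiplesHom _ (π (pt (thetaGraph n) (strandVertex n 0 0)))).comp
      (degree (thetaGraph n)) + ψ.comp (weight n) :=
    hom_ext_pt fun x => by
      rw [hpt, AddMonoidHom.add_apply, AddMonoidHom.comp_apply, degree_pt]
      simp
  have := DFunLike.congr_fun this D
  rw [AddMonoidHom.add_apply, AddMonoidHom.comp_apply, AddMonoidHom.comp_apply, hd, hw, map_zero,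
    map_zero, add_zero] at this
  exact (QuotientAddGroup.eq_zero_iff _).1 this

end Weight

/-! ### Integer arithmetic in the lattice. -/

section Lattice

variable {n : Fin 3 → ℕ}

theorem exists_third {α β : Fin 3} (h : α ≠ β) : ∃ ε, ε ≠ α ∧ ε ≠ β ∧
    (∀ γ, γ = α ∨ γ = β ∨ γ = ε) ∧ ∀ f : Fin 3 → ℤ, ∑ γ, f γ = f α + f β + f ε := by
  have : ∀ α β : Fin 3, α ≠ β → ∃ ε, ε ≠ α ∧ ε ≠ β ∧ (∀ γ, γ = α ∨ γ = β ∨ γ = ε) ∧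
      ({α, β, ε} : Finset (Fin 3)) = Finset.univ := by decide
  obtain ⟨ε, h1, h2, h3, h4⟩ := this α β h
  refine ⟨ε, h1, h2, h3, fun f => ?_⟩
  rw [← h4, Finset.sum_insert (by simp [h, h1.symm]), Finset.sum_insert (by simp [h2.symm]),
    Finset.sum_singleton, add_assoc]

/-- Replaces the product `n * s` by linear information, after which `omega` can treat it as a
variable. -/
theorem mul_pentachotomy {n : ℤ} (hn : 0 < n) (s : ℤ) :
    s ≤ -2 ∧ n * s ≤ -(2 * n) ∨ s = -1 ∧ n * s = -n ∨ s = 0 ∧ n * s = 0 ∨ s = 1 ∧ n * s = n ∨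
      2 ≤ s ∧ 2 * n ≤ n * s := by
  have : s ≤ -2 ∨ s = -1 ∨ s = 0 ∨ s = 1 ∨ 2 ≤ s := by omega
  rcases this with h | rfl | rfl | rfl | h
  · exact .inl ⟨h, by nlinarith⟩
  · simp
  · simp
  · simp
  · exact .inr (.inr (.inr (.inr ⟨h, by nlinarith⟩)))

theorem mul_trichotomy {n : ℤ} (hn : 0 < n) (s : ℤ) :
    s ≤ -1 ∧ n * s ≤ -n ∨ s = 0 ∧ n * s = 0 ∨ 1 ≤ s ∧ n ≤ n * s := by
  rcases lt_trichotomy s 0 with h | h | h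
  · exact .inl ⟨by omega, by nlinarith⟩
  · exact .inr (.inl ⟨h, by simp [h]⟩)
  · exact .inr (.inr ⟨h, by nlinarith⟩)

theorem single_sub_single_notMem (hn : ∀ γ, 0 < n γ) {α β : Fin 3} (hαβ : α ≠ β) {i j : ℕ}
    (hi : 0 < i) (hin : i < n α) (hj : 0 < j) (hjn : j < n β) :
    Pi.single α (i : ℤ) - Pi.single β (j : ℤ) ∉ jacLattice n := by
  rintro ⟨F, s, hs, hm⟩
  obtain ⟨ε, h1, h2, -, h3⟩ := exists_third hαβ
  rw [h3] at hs
  have ha := hm α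
  have hb := hm β
  have he := hm ε
  simp [hαβ, hαβ.symm, h1, h2] at ha hb he
  have hnα := hn α
  have hnβ := hn β
  have hnε := hn ε
  have hα := mul_trichotomy (n := n α) (by exact_mod_cast hn α) (s α)
  have hβ := mul_trichotomy (n := n β) (by exact_mod_cast hn β) (s β)
  have hε := mul_trichotomy (n := n ε) (by exact_mod_cast hn ε) (s ε)
  generalize (n α : ℤ) * s α = A at *
  generalize (n β : ℤ) * s β = B at *
  generalize (n ε : ℤ) * s ε = C at *
  omega

set_option maxHeartbeats 2000000 in
/-- If the two marked chips move simultaneously, then one of them stays in place or they pass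
through the end points. -/
theorem exchange (hn : ∀ γ, 0 < n γ) {α β γ δ : Fin 3} (hαβ : α ≠ β) {i j t t' : ℕ}
    (hi : 0 < i) (hin : i < n α) (hj : 0 < j) (hjn : j < n β) (ht : t ≤ n γ) (ht' : t' ≤ n δ)
    (h : Pi.single α (i : ℤ) + Pi.single γ (t : ℤ) - (Pi.single β (j : ℤ) + Pi.single δ (t' : ℤ))
      ∈ jacLattice n) :
    γ = β ∧ t = j ∨ γ = α ∧ i + t = n α := by
  obtain ⟨F, s, hs, hm⟩ := h
  obtain ⟨ε, h1, h2, h0, h3⟩ := exists_third hαβ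
  rw [h3] at hs
  have ha := hm α
  have hb := hm β
  have he := hm ε
  have hnα := hn α
  have hnβ := hn β
  have hnε := hn ε
  have hα := mul_pentachotomy (n := n α) (by exact_mod_cast hn α) (s α)
  have hβ := mul_pentachotomy (n := n β) (by exact_mod_cast hn β) (s β)
  have hε := mul_pentachotomy (n := n ε) (by exact_mod_cast hn ε) (s ε)
  clear hm h3
  generalize (n α : ℤ) * s α = A at *
  generalize (n β : ℤ) * s β = B at *
  generalize (n ε : ℤ) * s ε = C at *
  rcases h0 γ with rfl | rfl | rfl <;> rcases h0 δ with rfl | rfl | rfl <;>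
  simp [hαβ, hαβ.symm, h1, h2, h1.symm, h2.symm] at ha hb he ⊢ <;>
  clear hαβ h0 h1 h2 <;> omega

theorem single_add_single_sub_notMem (hn : ∀ γ, 0 < n γ) {α β δ : Fin 3} (hαβ : α ≠ β)
    {i j t' : ℕ} (hi : 0 < i) (hin : i < n α) (hj : 0 < j) (hjn : j < n β) (ht' : t' ≤ n δ) :
    Pi.single α (i : ℤ) + Pi.single β (j : ℤ) - Pi.single δ (t' : ℤ) ∉ jacLattice n := by
  rintro ⟨F, s, hs, hm⟩
  obtain ⟨ε, h1, h2, h0, h3⟩ := exists_third hαβ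
  rw [h3] at hs
  have ha := hm α
  have hb := hm β
  have he := hm ε
  have hnα := hn α
  have hnβ := hn β
  have hnε := hn ε
  have hα := mul_trichotomy (n := n α) (by exact_mod_cast hn α) (s α)
  have hβ := mul_trichotomy (n := n β) (by exact_mod_cast hn β) (s β)
  have hε := mul_trichotomy (n := n ε) (by exact_mod_cast hn ε) (s ε)
  clear hm h3
  generalize (n α : ℤ) * s α = A at *
  generalize (n β : ℤ) * s β = B at *
  generalize (n ε : ℤ) * s ε = C at *
  rcases h0 δ with rfl | rfl | rfl <;>
  simp [hαβ, hαβ.symm, h1, h2, h1.symm] at ha hb he <;> omega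

/-- A chip at the first end point can only be moved to the second one along a strand if the other
chip is already there. -/
theorem eq_last_of_mem (hn : ∀ γ, 0 < n γ) {γ δ : Fin 3} {t t' : ℕ} (ht : t ≤ n γ)
    (ht' : t' ≤ n δ)
    (h : Pi.single γ (t : ℤ) - (Pi.single δ (n δ : ℤ) + Pi.single δ (t' : ℤ)) ∈ jacLattice n) :
    t = n γ := by
  obtain ⟨F, s, hs, hm⟩ := h
  have key : ∀ α β : Fin 3, α ≠ β → δ = β → (γ = α ∨ γ = β) → t = n γ := by
    rintro α β hαβ rfl hγ
    obtain ⟨ε, h1, h2, -, h3⟩ := exists_third hαβ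
    rw [h3] at hs
    have ha := hm α
    have hb := hm δ
    have he := hm ε
    have hnα := hn α
    have hnδ := hn δ
    have hnε := hn ε
    have hα := mul_pentachotomy (n := n α) (by exact_mod_cast hn α) (s α)
    -- The shift by one absorbs the summand `n δ` in the coordinate `δ`.
    have hβ := mul_pentachotomy (n := n δ) (by exact_mod_cast hn δ) (s δ - 1)
    have hε := mul_pentachotomy (n := n ε) (by exact_mod_cast hn ε) (s ε)
    clear hm h3
    rw [mul_sub, mul_one] at hβ
    generalize (n α : ℤ) * s α = A at *
    generalize (n δ : ℤ) * s δ = B at *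
    generalize (n ε : ℤ) * s ε = C at *
    rcases hγ with rfl | rfl <;>
    simp [hαβ, hαβ.symm, h1, h2, h1.symm] at ha hb he <;> omega
  by_cases h : γ = δ
  · obtain ⟨α, hα⟩ := exists_ne δ
    exact key α δ hα rfl (.inr h)
  · exact key γ δ h rfl (.inl rfl)

theorem single_last_notMem (hn : ∀ γ, 0 < n γ) (δ : Fin 3) :
    Pi.single δ (n δ : ℤ) ∉ jacLattice n := fun h => by
  have h1 := hn δ
  have h2 := neg_mem h
  have := eq_last_of_mem hn (γ := δ) (δ := δ) (t := 0) (t' := 0) (Nat.zero_le _) (Nat.zero_le _)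
    (by simpa using h2)
  omega

/-- Every class of degree two is represented by two chips on closed strands. -/
theorem exists_two_chips (hn : ∀ γ, 0 < n γ) (m : Fin 3 → ℤ) :
    ∃ (γ δ : Fin 3) (t t' : ℕ), t ≤ n γ ∧ t' ≤ n δ ∧
      m - (Pi.single γ (t : ℤ) + Pi.single δ (t' : ℤ)) ∈ jacLattice n := by
  have hn' : ∀ γ, (0 : ℤ) < n γ := fun γ => by exact_mod_cast hn γ
  -- Divide `m γ - F` by `n γ` with quotient `s γ` and remainder `r γ`, with `F` as large as
  -- possible for the quotients to have sum `σ ≥ 0`.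
  obtain ⟨F, hF, hmax⟩ := Int.exists_greatest_of_bdd
    (P := fun F => 0 ≤ ∑ γ, (m γ - F) / (n γ : ℤ))
    ⟨|m 0| + |m 1| + |m 2|, fun F hF => by
      by_contra! hlt
      have : ∀ γ, (m γ - F) / (n γ : ℤ) < 0 := fun γ => by
        refine Int.ediv_neg_of_neg_of_pos ?_ (hn' γ)
        have : |m γ| ≤ |m 0| + |m 1| + |m 2| := by
          have h0 := abs_nonneg (m 0)
          have h1 := abs_nonneg (m 1)
          have h2 := abs_nonneg (m 2)
          fin_cases γ <;> simp <;> omega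
        have := le_abs_self (m γ)
        omega
      exact absurd hF (not_le.2 (Finset.sum_neg (fun γ _ => this γ) Finset.univ_nonempty))⟩
    ⟨-(|m 0| + |m 1| + |m 2|), Finset.sum_nonneg fun γ _ => Int.ediv_nonneg (by
        have h0 := abs_nonneg (m 0)
        have h1 := abs_nonneg (m 1)
        have h2 := abs_nonneg (m 2)
        have : |m γ| ≤ |m 0| + |m 1| + |m 2| := by
          fin_cases γ <;> simp <;> omega
        have := neg_abs_le (m γ)
        omega) (hn' γ).le⟩
  have hF' : ∑ γ, (m γ - (F + 1)) / (n γ : ℤ) < 0 := by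
    by_contra! h
    have := hmax _ h
    omega
  set s : Fin 3 → ℤ := fun γ => (m γ - F) / (n γ : ℤ) with hs
  set r : Fin 3 → ℕ := fun γ => ((m γ - F) % (n γ : ℤ)).toNat with hr
  have hr' : ∀ γ, (r γ : ℤ) = (m γ - F) % (n γ : ℤ) := fun γ =>
    Int.toNat_of_nonneg (Int.emod_nonneg _ (hn' γ).ne')
  have hlt : ∀ γ, r γ < n γ := fun γ => by
    have := Int.emod_lt_of_pos (m γ - F) (hn' γ)
    rw [← hr'] at this
    exact_mod_cast this
  have hm : ∀ γ, m γ = F + n γ * s γ + r γ := fun γ => by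
    have := Int.mul_ediv_add_emod (m γ - F) (n γ)
    rw [hr']
    linarith
  -- Raising `F` by one lowers a quotient only where the remainder is zero. By maximality of `F`,
  -- more than `σ` remainders vanish, so `σ` chips at the second end point and one chip for each
  -- nonzero remainder are at most two in all.
  have hdrop : ∀ γ, s γ - (if r γ = 0 then 1 else 0) ≤ (m γ - (F + 1)) / (n γ : ℤ) := fun γ => by
    rw [Int.le_ediv_iff_mul_le (hn' γ), hm γ]
    have := hn' γ
    split_ifs with h
    · nlinarith
    · have : 0 < r γ := Nat.pos_of_ne_zero h
      nlinarith
  have hsum : ∑ γ, s γ < ∑ γ, (if r γ = 0 then 1 else 0 : ℤ) := by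
    have := Finset.sum_le_sum fun γ (_ : γ ∈ Finset.univ) => hdrop γ
    rw [Finset.sum_sub_distrib] at this
    linarith
  -- Only the sum of the quotients matters modulo the lattice, so all of it is moved to strand `0`.
  have hmem : ∀ {m' : Fin 3 → ℤ}, (∀ γ, m' γ = r γ + Pi.single (M := fun _ => ℤ) 0
      ((∑ γ, s γ) * n 0) γ) → m - m' ∈ jacLattice n := fun {m'} h =>
    ⟨F, Pi.single 0 (∑ γ, s γ) - s, by simp [Finset.sum_sub_distrib], fun γ => by
      rw [Pi.sub_apply, h, hm]
      by_cases h0 : γ = 0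
      · subst h0; simp; ring
      · simp [h0]⟩
  generalize hσ : ∑ γ, s γ = σ at *
  have h0 := (hlt 0).le
  have h1 := (hlt 1).le
  have h2 := (hlt 2).le
  have key : ∀ (γ δ : Fin 3) (t t' : ℕ), t ≤ n γ → t' ≤ n δ → (∀ ε, (Pi.single γ (t : ℤ) +
      Pi.single δ (t' : ℤ) : Fin 3 → ℤ) ε = r ε + Pi.single (M := fun _ => ℤ) 0 (σ * n 0) ε) →
      ∃ (γ δ : Fin 3) (t t' : ℕ), t ≤ n γ ∧ t' ≤ n δ ∧
        m - (Pi.single γ (t : ℤ) + Pi.single δ (t' : ℤ)) ∈ jacLattice n :=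
    fun γ δ t t' ht ht' h => ⟨γ, δ, t, t', ht, ht', hmem fun ε => h ε⟩
  have hσ0 : 0 ≤ σ := hσ ▸ hF
  have hσ' : σ = 0 ∨ σ = 1 ∨ σ = 2 := by
    have : σ < 3 := hsum.trans_le ((Finset.sum_le_sum (g := fun _ => 1)
      fun γ _ => by split_ifs <;> norm_num).trans (by simp))
    omega
  rw [Fin.sum_univ_three] at hsum
  rcases hσ' with rfl | rfl | rfl
  · by_cases hr0 : r 0 = 0
    · exact key 1 2 (r 1) (r 2) h1 h2 fun ε => by fin_cases ε <;> simp [hr0]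
    by_cases hr1 : r 1 = 0
    · exact key 0 2 (r 0) (r 2) h0 h2 fun ε => by fin_cases ε <;> simp [hr1]
    by_cases hr2 : r 2 = 0
    · exact key 0 1 (r 0) (r 1) h0 h1 fun ε => by fin_cases ε <;> simp [hr2]
    simp [hr0, hr1, hr2] at hsum
  · by_cases hr0 : r 0 = 0
    · by_cases hr1 : r 1 = 0
      · exact key 0 2 (n 0) (r 2) le_rfl h2 fun ε => by fin_cases ε <;> simp [hr0, hr1]
      by_cases hr2 : r 2 = 0
      · exact key 0 1 (n 0) (r 1) le_rfl h1 fun ε => by fin_cases ε <;> simp [hr0, hr2]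
      simp [hr0, hr1, hr2] at hsum
    · by_cases hr1 : r 1 = 0
      · by_cases hr2 : r 2 = 0
        · exact key 0 0 (n 0) (r 0) le_rfl h0 fun ε => by
            fin_cases ε <;> simp [hr1, hr2]
            exact add_comm _ _
        simp [hr0, hr1, hr2] at hsum
      · simp [hr0, hr1] at hsum
        split_ifs at hsum <;> omega
  · have : r 0 = 0 ∧ r 1 = 0 ∧ r 2 = 0 := by
      split_ifs at hsum <;> omega
    exact key 0 0 (n 0) (n 0) le_rfl le_rfl fun ε => by
      fin_cases ε <;> simp [this]
      ring

end Lattice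

/-! ### Riemann-Roch in genus two and submodularity. -/

section ThetaRank

variable {n : Fin 3 → ℕ}

instance : Nonempty (thetaGraph n).vertexSet := ⟨strandVertex n 0 0⟩

theorem linEquiv_iff (hn : ∀ γ, 0 < n γ) {D D' : Divisor (thetaGraph n)} :
    LinEquiv (thetaGraph n) D D' ↔
      degree (thetaGraph n) D = degree (thetaGraph n) D' ∧ weight n D = weight n D' := by
  rw [LinEquiv, mem_principal_iff hn, map_sub, map_sub, sub_eq_zero, sub_eq_zero]

theorem mk_eq_mk_iff {m m' : Fin 3 → ℤ} : QuotientAddGroup.mk' (jacLattice n) m =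
    QuotientAddGroup.mk' (jacLattice n) m' ↔ m - m' ∈ jacLattice n := by
  rw [← sub_eq_zero, ← map_sub]
  exact QuotientAddGroup.eq_zero_iff _

theorem hasEffective_of_degree_eq_two (hn : ∀ γ, 0 < n γ) {D : Divisor (thetaGraph n)}
    (hd : degree (thetaGraph n) D = 2) : HasEffective (thetaGraph n) D := by
  obtain ⟨m, hm⟩ := QuotientAddGroup.mk'_surjective (jacLattice n) (weight n D)
  obtain ⟨γ, δ, t, t', ht, ht', h⟩ := exists_two_chips hn m
  refine ⟨pt (thetaGraph n) (strandVertex n γ t) + pt (thetaGraph n) (strandVertex n δ t'),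
    add_nonneg (pt_nonneg _) (pt_nonneg _), (linEquiv_iff hn).2 ⟨?_, ?_⟩⟩
  · rw [map_add, degree_pt, degree_pt, hd]; rfl
  · rw [map_add, weight_strandVertex ht, weight_strandVertex ht', ← hm, ← map_add, mk_eq_mk_iff]
    exact h

/-- Riemann's inequality. -/
theorem degree_sub_two_le_rank (hn : ∀ γ, 0 < n γ) (D : Divisor (thetaGraph n)) :
    degree (thetaGraph n) D - 2 ≤ rank (thetaGraph n) D := by
  rcases lt_or_ge (degree (thetaGraph n) D - 2) (-1) with h | h
  · have := neg_one_le_rank D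
    omega
  · exact le_rank h fun F _ hd =>
      hasEffective_of_degree_eq_two hn (by rw [map_sub]; omega)

/-- Reflection of a strand: removing `v_{γ,t}` from the sum of the end points leaves the class of
`v_{γ,n γ - t}`. -/
theorem one_le_rank_ends (hn : ∀ γ, 0 < n γ) :
    1 ≤ rank (thetaGraph n)
      (pt (thetaGraph n) (strandVertex n 0 0) + pt (thetaGraph n) (strandVertex n 0 (n 0))) := by
  refine one_le_rank_iff.2 fun x => ?_
  obtain ⟨γ, t, ht, rfl⟩ := exists_eq_strandVertex hn x
  refine ⟨pt (thetaGraph n) (strandVertex n γ (n γ - t)), pt_nonneg _, (linEquiv_iff hn).2 ⟨?_, ?_⟩⟩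
  · simp only [map_sub, map_add, degree_pt]; rfl
  · rw [strandVertex_zero 0 γ, strandVertex_last hn 0 γ, map_sub, map_add,
      weight_strandVertex (Nat.zero_le _), weight_strandVertex le_rfl, weight_strandVertex ht,
      weight_strandVertex (Nat.sub_le _ _), ← map_add, ← map_sub, Nat.cast_sub ht,
      ← Pi.single_add, ← Pi.single_sub]
    simp

/-- There is only one class of degree two and rank one. -/
theorem linEquiv_ends (hn : ∀ γ, 0 < n γ) {D : Divisor (thetaGraph n)}
    (hd : degree (thetaGraph n) D = 2) (hD : 1 ≤ rank (thetaGraph n) D) :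
    LinEquiv (thetaGraph n) D
      (pt (thetaGraph n) (strandVertex n 0 0) + pt (thetaGraph n) (strandVertex n 0 (n 0))) := by
  obtain ⟨x, hx⟩ := exists_linEquiv_pt (one_le_rank_iff.1 hD (strandVertex n 0 0))
    (by rw [map_sub, degree_pt, hd]; rfl)
  obtain ⟨y, hy⟩ := exists_linEquiv_pt (one_le_rank_iff.1 hD (strandVertex n 0 (n 0)))
    (by rw [map_sub, degree_pt, hd]; rfl)
  obtain ⟨γ, t, ht, rfl⟩ := exists_eq_strandVertex hn x
  obtain ⟨δ, t', ht', rfl⟩ := exists_eq_strandVertex hn y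
  have h1 := ((linEquiv_iff hn).1 hx).2
  have h2 := ((linEquiv_iff hn).1 hy).2
  rw [strandVertex_last hn 0 δ, map_sub, weight_strandVertex le_rfl,
    weight_strandVertex ht'] at h2
  have h3 := h1
  rw [map_sub, weight_strandVertex (Nat.zero_le _), Nat.cast_zero, Pi.single_zero, map_zero,
    sub_zero, weight_strandVertex ht] at h1
  rw [h1, sub_eq_iff_eq_add, ← map_add, add_comm, mk_eq_mk_iff] at h2
  -- Here `D` is equivalent both to the first end point plus `x` and to the second plus `y`, which
  -- forces `x` to be the second end point.
  have h4 := eq_last_of_mem hn ht ht' h2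
  rw [h4, strandVertex_last hn γ 0, map_sub, sub_eq_iff_eq_add'] at h3
  exact (linEquiv_iff hn).2 ⟨by rw [map_add, degree_pt, degree_pt, hd]; rfl, by rw [h3, map_add]⟩

theorem LinEquiv.pt_of_sub {D F : Divisor (thetaGraph n)} {x y : (thetaGraph n).vertexSet}
    (hx : LinEquiv (thetaGraph n) (D - pt (thetaGraph n) x) F)
    (hy : LinEquiv (thetaGraph n) (D - pt (thetaGraph n) y) F) :
    LinEquiv (thetaGraph n) (pt (thetaGraph n) x) (pt (thetaGraph n) y) := by
  have := hy.trans hx.symm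
  unfold LinEquiv at *
  rwa [sub_sub_sub_cancel_left] at this

/-- A larger rank would leave, after removing a fixed `F` of degree `deg D - 3` and any vertex `x`,
the unique class of degree two and rank one. All vertices would then be equivalent, but the two end
points are not. -/
theorem rank_eq (hn : ∀ γ, 0 < n γ) {D : Divisor (thetaGraph n)}
    (hd : 3 ≤ degree (thetaGraph n) D) :
    rank (thetaGraph n) D = degree (thetaGraph n) D - 2 := by
  refine le_antisymm ?_ (degree_sub_two_le_rank hn D)
  by_contra! hlt
  obtain ⟨F, hF, hFd⟩ := exists_effective_degree (G := thetaGraph n) (sub_nonneg.2 hd)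
  have key : ∀ x, LinEquiv (thetaGraph n) (D - F - pt (thetaGraph n) x)
      (pt (thetaGraph n) (strandVertex n 0 0) + pt (thetaGraph n) (strandVertex n 0 (n 0))) :=
    fun x => by
    refine linEquiv_ends hn (by simp only [map_sub, degree_pt, hFd]; ring)
      (one_le_rank_iff.2 fun y => ?_)
    rw [sub_sub, sub_sub]
    refine hasEffective_sub (add_nonneg hF (add_nonneg (pt_nonneg _) (pt_nonneg _))) ?_
    simp only [map_add, degree_pt, hFd]
    omega
  have h := (linEquiv_iff hn).1
    ((key (strandVertex n 0 (n 0))).pt_of_sub (key (strandVertex n 0 0)))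
  rw [weight_strandVertex le_rfl, weight_strandVertex (Nat.zero_le _), mk_eq_mk_iff] at h
  exact single_last_notMem hn 0 (by simpa using h.2)

theorem rank_lt_degree (hn : ∀ γ, 0 < n γ) {D : Divisor (thetaGraph n)}
    (hd : 1 ≤ degree (thetaGraph n) D) :
    rank (thetaGraph n) D < degree (thetaGraph n) D := by
  by_contra! hlt
  obtain ⟨F, hF, hFd⟩ := exists_effective_degree (G := thetaGraph n) (sub_nonneg.2 hd)
  have key : ∀ x, LinEquiv (thetaGraph n) (D - F - pt (thetaGraph n) x) 0 := fun x => by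
    refine linEquiv_zero_of_hasEffective ?_ (by simp only [map_sub, degree_pt, hFd]; ring)
    rw [sub_sub]
    exact hasEffective_sub (add_nonneg hF (pt_nonneg _)) (by rw [map_add, degree_pt, hFd]; omega)
  have h := (linEquiv_iff hn).1
    ((key (strandVertex n 0 (n 0))).pt_of_sub (key (strandVertex n 0 0)))
  rw [weight_strandVertex le_rfl, weight_strandVertex (Nat.zero_le _), mk_eq_mk_iff] at h
  exact single_last_notMem hn 0 (by simpa using h.2)

section Marked

variable (hn : ∀ γ, 0 < n γ) {α β : Fin 3} (hαβ : α ≠ β) {i j : ℕ} (hi : 0 < i) (hin : i < n α)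
  (hj : 0 < j) (hjn : j < n β)
include hn hαβ hi hin hj hjn

theorem not_linEquiv_marked :
    ¬ LinEquiv (thetaGraph n) (pt (thetaGraph n) (strandVertex n α i))
      (pt (thetaGraph n) (strandVertex n β j)) := fun h => by
  have h := ((linEquiv_iff hn).1 h).2
  rw [weight_strandVertex hin.le, weight_strandVertex hjn.le, mk_eq_mk_iff] at h
  exact single_sub_single_notMem hn hαβ hi hin hj hjn h

theorem rank_marked_le_zero :
    rank (thetaGraph n)
      (pt (thetaGraph n) (strandVertex n α i) + pt (thetaGraph n) (strandVertex n β j)) ≤ 0 := by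
  by_contra! h
  obtain ⟨x, hx⟩ := exists_linEquiv_pt (one_le_rank_iff.1 h (strandVertex n 0 0))
    (by simp only [map_sub, map_add, degree_pt]; rfl)
  obtain ⟨δ, t', ht', rfl⟩ := exists_eq_strandVertex hn x
  have h := ((linEquiv_iff hn).1 hx).2
  rw [map_sub, map_add, weight_strandVertex hin.le, weight_strandVertex hjn.le,
    weight_strandVertex (Nat.zero_le _), weight_strandVertex ht', Nat.cast_zero, Pi.single_zero,
    map_zero, sub_zero, ← map_add, mk_eq_mk_iff] at h
  exact single_add_single_sub_notMem hn hαβ hi hin hj hjn ht' h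

/-- The second alternative arises when `x` is the mirror image of `u` on its strand. -/
theorem linEquiv_exchange {x y : (thetaGraph n).vertexSet}
    (h : LinEquiv (thetaGraph n) (pt (thetaGraph n) (strandVertex n α i) + pt (thetaGraph n) x)
      (pt (thetaGraph n) (strandVertex n β j) + pt (thetaGraph n) y)) :
    x = strandVertex n β j ∨ LinEquiv (thetaGraph n)
      (pt (thetaGraph n) (strandVertex n α i) + pt (thetaGraph n) x)
      (pt (thetaGraph n) (strandVertex n 0 0) + pt (thetaGraph n) (strandVertex n 0 (n 0))) := by
  obtain ⟨γ, t, ht, rfl⟩ := exists_eq_strandVertex hn x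
  obtain ⟨δ, t', ht', rfl⟩ := exists_eq_strandVertex hn y
  have h := ((linEquiv_iff hn).1 h).2
  rw [map_add, map_add, weight_strandVertex hin.le, weight_strandVertex hjn.le,
    weight_strandVertex ht, weight_strandVertex ht', ← map_add, ← map_add, mk_eq_mk_iff] at h
  rcases exchange hn hαβ hi hin hj hjn ht ht' h with ⟨rfl, rfl⟩ | ⟨rfl, h⟩
  · exact .inl rfl
  · refine .inr ((linEquiv_iff hn).2 ⟨by simp only [map_add, degree_pt], ?_⟩)
    rw [map_add, map_add, strandVertex_last hn 0 γ, weight_strandVertex hin.le,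
      weight_strandVertex ht, weight_strandVertex (Nat.zero_le _), weight_strandVertex le_rfl,
      ← map_add, ← map_add, ← Pi.single_add, Nat.cast_zero, Pi.single_zero, zero_add, ← h]
    push_cast
    rfl

/-- By degree. Up to `0`, both middle ranks are `-1`; from `4` on, Riemann-Roch and Riemann's
inequality suffice. In degree `1` a failure makes `D - u` and `D - v` trivial, in degree `3` it puts
both in the unique rank-one class; either way `u ∼ v`. In degree `2` it makes both effective with
`D` of rank `0` and `D - u - v` not effective, contrary to the exchange property. -/
theorem delta_nonneg (D : Divisor (thetaGraph n)) :
    0 ≤ delta (thetaGraph n) (strandVertex n α i) (strandVertex n β j) D := by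
  have huv := not_linEquiv_marked hn hαβ hi hin hj hjn
  have hex := fun {x y} => linEquiv_exchange hn hαβ hi hin hj hjn (x := x) (y := y)
  unfold delta
  generalize strandVertex n α i = u at *
  generalize strandVertex n β j = v at *
  have hd1 : ∀ x, degree (thetaGraph n) (D - pt (thetaGraph n) x) = degree (thetaGraph n) D - 1 :=
    fun x => by
    rw [map_sub, degree_pt]
  have hd3 : degree (thetaGraph n) (D - pt (thetaGraph n) u - pt (thetaGraph n) v) =
      degree (thetaGraph n) D - 2 := by
    rw [map_sub, hd1, degree_pt]; ring
  have hneg0 := neg_one_le_rank D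
  have hneg3 := neg_one_le_rank (D - pt (thetaGraph n) u - pt (thetaGraph n) v)
  have hu := rank_sub_pt_le D u
  have hv := rank_sub_pt_le D v
  have huv' := rank_sub_pt_ge (D - pt (thetaGraph n) u) v
  have hvu' := rank_sub_pt_ge (D - pt (thetaGraph n) v) u
  rw [sub_right_comm] at hvu'
  have hR0 := degree_sub_two_le_rank hn D
  have hR1 := degree_sub_two_le_rank hn (D - pt (thetaGraph n) u)
  have hR2 := degree_sub_two_le_rank hn (D - pt (thetaGraph n) v)
  have hR3 := degree_sub_two_le_rank hn (D - pt (thetaGraph n) u - pt (thetaGraph n) v)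
  rw [hd1] at hR1 hR2
  rw [hd3] at hR3
  rcases lt_or_ge (degree (thetaGraph n) D) 1 with h | h
  · rw [rank_eq_neg_one (D := D - pt (thetaGraph n) u) (by rw [hd1]; omega),
      rank_eq_neg_one (D := D - pt (thetaGraph n) v) (by rw [hd1]; omega)]
    omega
  have hle1 := rank_le_degree (D := D - pt (thetaGraph n) u) (by rw [hd1]; omega)
  have hle2 := rank_le_degree (D := D - pt (thetaGraph n) v) (by rw [hd1]; omega)
  have hle3 := rank_le_degree (D := D - pt (thetaGraph n) u - pt (thetaGraph n) v)
    (by rw [hd3]; omega)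
  rw [hd1] at hle1 hle2
  rw [hd3] at hle3
  obtain h | h | h | h | h : degree (thetaGraph n) D = 1 ∨ degree (thetaGraph n) D = 2 ∨
    degree (thetaGraph n) D = 3 ∨ degree (thetaGraph n) D = 4 ∨ 5 ≤ degree (thetaGraph n) D := by
    omega
  · by_contra! hlt
    refine huv (LinEquiv.pt_of_sub
      (linEquiv_zero_of_hasEffective
        (rank_nonneg_iff.1 (?_ : 0 ≤ rank _ (D - pt (thetaGraph n) u))) ?_)
      (linEquiv_zero_of_hasEffective
        (rank_nonneg_iff.1 (?_ : 0 ≤ rank _ (D - pt (thetaGraph n) v))) ?_))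
    · omega
    · rw [hd1, h]; rfl
    · omega
    · rw [hd1, h]; rfl
  · have hlt1 := rank_lt_degree hn (D := D - pt (thetaGraph n) u) (by rw [hd1, h]; rfl)
    have hlt2 := rank_lt_degree hn (D := D - pt (thetaGraph n) v) (by rw [hd1, h]; rfl)
    rw [hd1] at hlt1 hlt2
    by_contra! hlt
    obtain ⟨x, hx⟩ := exists_linEquiv_pt
      (rank_nonneg_iff.1 (by omega : 0 ≤ rank _ (D - pt (thetaGraph n) u))) (by rw [hd1, h]; rfl)
    obtain ⟨y, hy⟩ := exists_linEquiv_pt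
      (rank_nonneg_iff.1 (by omega : 0 ≤ rank _ (D - pt (thetaGraph n) v))) (by rw [hd1, h]; rfl)
    have hx' : LinEquiv (thetaGraph n) D (pt (thetaGraph n) u + pt (thetaGraph n) x) := by
      unfold LinEquiv at *
      rwa [← sub_sub]
    have hy' : LinEquiv (thetaGraph n) D (pt (thetaGraph n) v + pt (thetaGraph n) y) := by
      unfold LinEquiv at *
      rwa [← sub_sub]
    rcases hex (hx'.symm.trans hy') with rfl | hK
    · have : 0 ≤ rank (thetaGraph n) (D - pt (thetaGraph n) u - pt (thetaGraph n) x) := by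
        refine rank_nonneg_iff.2 ⟨0, le_rfl, ?_⟩
        unfold LinEquiv at *
        rwa [sub_zero]
      omega
    · have := rank_congr (hx'.trans hK)
      have := one_le_rank_ends hn
      omega
  · have hlt1 := rank_lt_degree hn (D := D - pt (thetaGraph n) u) (by rw [hd1, h]; norm_num)
    have hlt2 := rank_lt_degree hn (D := D - pt (thetaGraph n) v) (by rw [hd1, h]; norm_num)
    rw [hd1] at hlt1 hlt2
    by_contra! hlt
    have hr := rank_eq hn (D := D) (by omega)
    exact huv (LinEquiv.pt_of_sub
      (linEquiv_ends hn (by rw [hd1, h]; rfl) (by omega))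
      (linEquiv_ends hn (by rw [hd1, h]; rfl) (by omega)))
  · have hr := rank_eq hn (D := D) (by omega)
    have hr1 := rank_eq hn (D := D - pt (thetaGraph n) u) (by rw [hd1]; omega)
    have hr2 := rank_eq hn (D := D - pt (thetaGraph n) v) (by rw [hd1]; omega)
    rw [hd1] at hr1 hr2
    omega
  · have hr := rank_eq hn (D := D) (by omega)
    have hr1 := rank_eq hn (D := D - pt (thetaGraph n) u) (by rw [hd1]; omega)
    have hr2 := rank_eq hn (D := D - pt (thetaGraph n) v) (by rw [hd1]; omega)
    rw [hd1] at hr1 hr2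
    omega

end Marked

end ThetaRank

/-! ### Sign arguments for evenly marked strands. -/

section EvenArithmetic

variable {k p N N' nε : ℤ}

/-- Two points of the unmarked strand which differ by a multiple of the marked class. -/
theorem eq_zero_of_unmarked {T F s σ τ : ℤ} (hk : 0 < k) (hN : 0 < N) (hN' : 0 < N') (hε : 0 < nε)
    (hT : |T| ≤ nε) (h0 : T = F - nε * s) (h1 : F = N * σ) (h2 : F = N' * τ)
    (h3 : σ + τ = -(k * s)) : T = 0 := by
  rw [abs_le] at hT
  -- If `F ≠ 0`, then `σ` and `τ` have its sign and `s` the opposite one, so `F` and `-nε * s` add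
  -- up to more than `nε` in absolute value.
  rcases lt_trichotomy F 0 with h | h | h
  · have hσ : σ < 0 := by by_contra! h'; nlinarith
    have hτ : τ < 0 := by by_contra! h'; nlinarith
    have hs : 0 < s := by by_contra! h'; nlinarith
    nlinarith
  · have hσ : σ = 0 := by
      rcases mul_eq_zero.1 (h1.symm.trans h) with h' | h' <;> omega
    have hτ : τ = 0 := by
      rcases mul_eq_zero.1 (h2.symm.trans h) with h' | h' <;> omega
    have hs : s = 0 := by
      have : k * s = 0 := by omega
      rcases mul_eq_zero.1 this with h' | h' <;> omega
    simp [h0, h, hs]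
  · have hσ : 0 < σ := by by_contra! h'; nlinarith
    have hτ : 0 < τ := by by_contra! h'; nlinarith
    have hs : s < 0 := by by_contra! h'; nlinarith
    nlinarith

/-- Two points of a marked strand which differ by a multiple of the marked class. -/
theorem eq_zero_of_marked {T F s σ τ : ℤ} (hk : 0 < k) (hN : 0 < N) (hN' : 0 < N') (hε : 0 < nε)
    (hT : |T| ≤ k * N) (h0 : T = F - N * σ) (h1 : F = N' * τ) (h2 : F = nε * s)
    (h3 : σ + τ = -(k * s)) : T = 0 := by
  rw [abs_le] at hT
  -- If `F ≠ 0`, then `τ` and `s` have its sign, so `σ` has the opposite sign and `|σ| ≥ k + 1`,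
  -- which makes `|T|` exceed `k * N`.
  rcases lt_trichotomy F 0 with h | h | h
  · have hτ : τ < 0 := by by_contra! h'; nlinarith
    have hs : s < 0 := by by_contra! h'; nlinarith
    have hσ : k + 1 ≤ σ := by nlinarith
    nlinarith
  · have hτ : τ = 0 := by
      rcases mul_eq_zero.1 (h1.symm.trans h) with h' | h' <;> omega
    have hs : s = 0 := by
      rcases mul_eq_zero.1 (h2.symm.trans h) with h' | h' <;> omega
    have hσ : σ = 0 := by subst hs hτ; omega
    simp [h0, h, hσ]
  · have hτ : 0 < τ := by by_contra! h'; nlinarith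
    have hs : 0 < s := by by_contra! h'; nlinarith
    have hσ : σ ≤ -(k + 1) := by nlinarith
    nlinarith

/-- A point of a marked strand and a point of the unmarked strand which differ by a multiple of the
marked class. -/
theorem ends_of_marked_unmarked {t t' F s σ τ : ℤ} (hk : 0 < k) (hN : 0 < N) (hN' : 0 < N')
    (hε : 0 < nε) (ht : 0 ≤ t) (htn : t ≤ k * N) (ht' : 0 ≤ t') (htn' : t' ≤ nε)
    (h0 : t = F - N * σ) (h1 : F = N' * τ) (h2 : -t' = F - nε * s) (h3 : σ + τ = -(k * s)) :
    t = 0 ∧ t' = 0 ∨ t = k * N ∧ t' = nε := by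
  rcases lt_trichotomy F 0 with h | h | h
  · have hτ : τ < 0 := by by_contra! h'; nlinarith
    have hσ : σ < 0 := by by_contra! h'; nlinarith
    have hs : 0 < s := by by_contra! h'; nlinarith
    nlinarith
  · have hτ : τ = 0 := by
      rcases mul_eq_zero.1 (h1.symm.trans h) with h' | h' <;> omega
    have hσ : σ = -(k * s) := by omega
    have hs0 : 0 ≤ s := by by_contra! h'; nlinarith
    have hs1 : s ≤ 1 := by by_contra! h'; nlinarith
    subst hσ h
    obtain rfl | rfl : s = 0 ∨ s = 1 := by omega
    · left; constructor <;> linarith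
    · right; constructor <;> linarith
  · have hτ : 0 < τ := by by_contra! h'; nlinarith
    have hs : 0 < s := by by_contra! h'; nlinarith
    have hσ : σ ≤ -(k + 1) := by nlinarith
    nlinarith

/-- The marked class has order `k`. -/
theorem dvd_of_multiple {l F s σ τ : ℤ} (hk : 0 < k) (hN : 0 < N) (hN' : 0 < N') (hε : 0 < nε)
    (hp : IsCoprime k p) {sα : ℤ} (hσ : σ = k * sα - l * p)
    (h0 : F = N * σ) (h1 : F = N' * τ) (h2 : F = nε * s) (h3 : σ + τ = -(k * s)) : k ∣ l := by
  have : F = 0 := by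
    rcases lt_trichotomy F 0 with h | h | h
    · have hσ : σ < 0 := by by_contra! h'; nlinarith
      have hτ : τ < 0 := by by_contra! h'; nlinarith
      have hs : s < 0 := by by_contra! h'; nlinarith
      nlinarith
    · exact h
    · have hσ : 0 < σ := by by_contra! h'; nlinarith
      have hτ : 0 < τ := by by_contra! h'; nlinarith
      have hs : 0 < s := by by_contra! h'; nlinarith
      nlinarith
  have h0' : σ = 0 := by
    rcases mul_eq_zero.1 (h0.symm.trans this) with h' | h' <;> omega
  exact hp.dvd_of_dvd_mul_right ⟨sα, by linarith⟩

/-- With `a / b = p / q` in lowest terms, `k` is `p + q`; it is coprime to `p`, and therefore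
divides both strand lengths. -/
theorem exists_even_parameters {nα nβ i j a b : ℕ} (hi : 0 < i) (hin : i < nα) (hβ : 0 < nβ)
    (hij : (i : ℚ) / nα = (j : ℚ) / nβ) (ha : 0 < a) (hb : 0 < b)
    (hab : (a : ℚ) / b = (i : ℚ) / ((nα : ℚ) - i)) :
    ∃ p N N' : ℕ, Nat.Coprime ((a + b) / Nat.gcd a b) p ∧ 0 < p ∧ p < (a + b) / Nat.gcd a b ∧
      0 < N ∧ 0 < N' ∧ nα = (a + b) / Nat.gcd a b * N ∧ i = p * N ∧
      nβ = (a + b) / Nat.gcd a b * N' ∧ j = p * N' := by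
  obtain ⟨g, p, q, hg, hpq, rfl, rfl⟩ := Nat.exists_coprime' (Nat.gcd_pos_of_pos_left b ha)
  have hgcd : Nat.gcd (p * g) (q * g) = g := by
    rw [Nat.gcd_mul_right, hpq.gcd_eq_one, one_mul]
  have hp : 0 < p := Nat.pos_of_mul_pos_right ha
  have hq : 0 < q := Nat.pos_of_mul_pos_right hb
  rw [hgcd, ← add_mul, Nat.mul_div_cancel _ hg]
  have hcop : Nat.Coprime (p + q) p := by simpa [Nat.coprime_comm] using hpq
  have hin' : (i : ℚ) < nα := by exact_mod_cast hin
  have h1 : p * nα = (p + q) * i := by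
    have hq' : (q : ℚ) ≠ 0 := by exact_mod_cast hq.ne'
    have hg' : (g : ℚ) ≠ 0 := by exact_mod_cast hg.ne'
    have : (nα : ℚ) - i ≠ 0 := by linarith
    push_cast at hab
    rw [mul_div_mul_right _ _ hg', div_eq_div_iff hq' this] at hab
    have : (p : ℚ) * nα = (p + q) * i := by linarith
    exact_mod_cast this
  obtain ⟨N, hN⟩ : p + q ∣ nα := hcop.dvd_of_dvd_mul_left ⟨i, h1⟩
  have hiN : i = p * N := by
    have : (p + q) * i = (p + q) * (p * N) := by rw [← h1, hN]; ring
    exact Nat.eq_of_mul_eq_mul_left (by omega) this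
  have h2 : p * nβ = (p + q) * j := by
    have h0 : (nα : ℚ) ≠ 0 := by linarith [(Nat.cast_pos (α := ℚ)).2 hi]
    have h0' : (nβ : ℚ) ≠ 0 := by exact_mod_cast hβ.ne'
    rw [div_eq_div_iff h0 h0'] at hij
    have hij : i * nβ = j * nα := by exact_mod_cast hij
    have hN0 : 0 < N := by
      rcases Nat.eq_zero_or_pos N with h | h
      · subst h; omega
      · exact h
    rw [hiN, hN] at hij
    refine Nat.eq_of_mul_eq_mul_left hN0 ?_
    linarith
  obtain ⟨N', hN'⟩ : p + q ∣ nβ := hcop.dvd_of_dvd_mul_left ⟨j, h2⟩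
  have hjN : j = p * N' := by
    have : (p + q) * j = (p + q) * (p * N') := by rw [← h2, hN']; ring
    exact Nat.eq_of_mul_eq_mul_left (by omega) this
  refine ⟨p, N, N', hcop, hp, by omega, ?_, ?_, hN, hiN, hN', hjN⟩
  · rcases Nat.eq_zero_or_pos N with h | h
    · subst h; omega
    · exact h
  · rcases Nat.eq_zero_or_pos N' with h | h
    · subst h; omega
    · exact h

end EvenArithmetic

/-! ### Order of the marked class, and vertices in its cosets. -/

section EvenlyMarked

variable {n : Fin 3 → ℕ} (hn : ∀ γ, 0 < n γ) {α β : Fin 3} (hαβ : α ≠ β) {k p N N' : ℕ}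
  (hk : 0 < k) (hN : 0 < N) (hN' : 0 < N') (hα : n α = k * N)
  (hβ : n β = k * N')
include hn hαβ hk hN hN' hα hβ

theorem zsmul_mem_jacLattice_iff (hkp : Nat.Coprime k p) (l : ℤ) :
    l • (Pi.single α ((p * N : ℕ) : ℤ) - Pi.single β ((p * N' : ℕ) : ℤ)) ∈ jacLattice n ↔
      (k : ℤ) ∣ l := by
  constructor
  · rintro ⟨F, s, hs, hm⟩
    obtain ⟨ε, h1, h2, h0, h3⟩ := exists_third hαβ
    rw [h3] at hs
    have ha := hm α
    have hb := hm β
    have he := hm ε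
    simp [hαβ, hαβ.symm, h1, h2, hα, hβ] at ha hb he
    refine (dvd_neg (b := l)).1 (dvd_of_multiple (l := -l) (k := k) (p := p) (N := N)
      (N' := N') (nε := n ε) (F := F) (s := s ε)
      (τ := k * s β - l * p) (by exact_mod_cast hk) (by exact_mod_cast hN) (by exact_mod_cast hN')
      (by exact_mod_cast hn ε) (Nat.isCoprime_iff_coprime.2 hkp) (sα := s α) rfl
      (by linarith) (by linarith) (by linarith)
      (by rw [show s ε = -(s α + s β) by omega]; ring))
  · rintro ⟨c, rfl⟩
    refine ⟨0, Pi.single β (p * c) - Pi.single α (p * c), by simp [Finset.sum_sub_distrib],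
      fun γ => ?_⟩
    simp only [Pi.smul_apply, Pi.sub_apply, Pi.single_apply, smul_eq_mul]
    split_ifs with h h' h'
    · exact absurd (h.symm.trans h') hαβ
    · subst h; rw [hα]; push_cast; ring
    · subst h'; rw [hβ]; push_cast; ring
    · ring

/-- Vertices which differ by a multiple of the marked class lie on the marked strands. -/
theorem strandVertex_eq_of_coset {γ δ : Fin 3} (hγδ : γ = δ ∨ γ ≠ α ∧ γ ≠ β ∨ δ ≠ α ∧ δ ≠ β)
    {t t' : ℕ} (ht : t ≤ n γ) (ht' : t' ≤ n δ) {l : ℤ}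
    (h : Pi.single γ (t : ℤ) - Pi.single δ (t' : ℤ) -
      l • (Pi.single α ((p * N : ℕ) : ℤ) - Pi.single β ((p * N' : ℕ) : ℤ)) ∈ jacLattice n) :
    strandVertex n γ t = strandVertex n δ t' := by
  obtain ⟨F, s, hs, hm⟩ := h
  obtain ⟨ε, h1, h2, h0, h3⟩ := exists_third hαβ
  rw [h3] at hs
  have ha := hm α
  have hb := hm β
  have he := hm ε
  have hk' : (0 : ℤ) < k := by exact_mod_cast hk
  have hN1 : (0 : ℤ) < N := by exact_mod_cast hN
  have hN1' : (0 : ℤ) < N' := by exact_mod_cast hN'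
  have hε : (0 : ℤ) < n ε := by exact_mod_cast hn ε
  -- The parenthesised terms are the `σ` and `τ` of the sign arguments; the multiple `l` cancels in
  -- their sum. The negated versions serve when the first vertex is on the unmarked strand.
  have hst : (k * s α - l * p) + (k * s β + l * p) = -(k * s ε) := by
    rw [show s ε = -(s α + s β) by omega]; ring
  have hst' : (k * s β + l * p) + (k * s α - l * p) = -(k * s ε) := by rw [← hst]; ring
  have hsn : -(k * s α - l * p) + -(k * s β + l * p) = -(k * -s ε) := by linarith
  have hsn' : -(k * s β + l * p) + -(k * s α - l * p) = -(k * -s ε) := by linarith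
  by_cases hγ : γ = δ
  · subst hγ
    have habs : |(t : ℤ) - t'| ≤ n γ := by rw [abs_le]; constructor <;> omega
    suffices (t : ℤ) - t' = 0 by rw [show t = t' by omega]
    rcases h0 γ with rfl | rfl | rfl <;>
    simp [hαβ, hαβ.symm, h1, h2, h1.symm, h2.symm, hα, hβ] at ha hb he habs
    · exact eq_zero_of_marked hk' hN1 hN1' hε habs (F := F) (s := s ε) (by linarith) (by linarith)
        (by linarith) hst
    · exact eq_zero_of_marked hk' hN1' hN1 hε habs (F := F) (s := s ε) (by linarith) (by linarith)
        (by linarith) hst'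
    · exact eq_zero_of_unmarked hk' hN1 hN1' hε habs (F := F) (by linarith) (by linarith)
        (by linarith) hst
  have hfin : t = 0 ∧ t' = 0 ∨ (t : ℤ) = n γ ∧ (t' : ℤ) = n δ →
      strandVertex n γ t = strandVertex n δ t' := by
    rintro (⟨rfl, rfl⟩ | ⟨h4, h5⟩)
    · exact strandVertex_zero _ _
    · rw [show t = n γ by omega, show t' = n δ by omega]
      exact strandVertex_last hn _ _
  apply hfin
  have hT : (t : ℤ) ≤ n γ := by exact_mod_cast ht
  have hT' : (t' : ℤ) ≤ n δ := by exact_mod_cast ht'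
  have hcases : γ = ε ∧ δ = α ∨ γ = ε ∧ δ = β ∨ γ = α ∧ δ = ε ∨ γ = β ∧ δ = ε := by
    have := h0 γ
    have := h0 δ
    grind
  suffices (t : ℤ) = 0 ∧ (t' : ℤ) = 0 ∨ (t : ℤ) = n γ ∧ (t' : ℤ) = n δ by exact_mod_cast this
  have hT0 := Int.natCast_nonneg t
  have hT0' := Int.natCast_nonneg t'
  clear hfin hm h0 h3 ht ht'
  generalize (t : ℤ) = T at *
  generalize (t' : ℤ) = T' at *
  rcases hcases with ⟨rfl, rfl⟩ | ⟨rfl, rfl⟩ | ⟨rfl, rfl⟩ | ⟨rfl, rfl⟩ <;>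
  simp [hαβ, hαβ.symm, h1, h2, h1.symm, h2.symm, hα, hβ] at ha hb he hT hT' ⊢
  · exact (ends_of_marked_unmarked hk' hN1 hN1' hε hT0' hT' hT0 hT (F := -F) (by linarith)
      (by linarith) (by linarith) hsn).imp And.symm And.symm
  · exact (ends_of_marked_unmarked hk' hN1' hN1 hε hT0' hT' hT0 hT (F := -F) (by linarith)
      (by linarith) (by linarith) hsn').imp And.symm And.symm
  · exact ends_of_marked_unmarked hk' hN1 hN1' hε hT0 hT hT0' hT' (F := F) (by linarith)
      (by linarith) (by linarith) hst
  · exact ends_of_marked_unmarked hk' hN1' hN1 hε hT0 hT hT0' hT' (F := F) (by linarith)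
      (by linarith) (by linarith) hst'

theorem zsmul_linEquiv_zero_iff (hkp : Nat.Coprime k p) (hpk : p ≤ k) (l : ℤ) :
    LinEquiv (thetaGraph n) (l • (pt (thetaGraph n) (strandVertex n α (p * N)) -
      pt (thetaGraph n) (strandVertex n β (p * N')))) 0 ↔ (k : ℤ) ∣ l := by
  have hi : p * N ≤ n α := hα ▸ Nat.mul_le_mul_right N hpk
  have hj : p * N' ≤ n β := hβ ▸ Nat.mul_le_mul_right N' hpk
  rw [← zsmul_mem_jacLattice_iff hn hαβ hk hN hN' hα hβ hkp, linEquiv_iff hn, map_zsmul, map_zsmul,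
    map_sub, map_sub, degree_pt, degree_pt, sub_self, smul_zero, map_zero, map_zero,
    weight_strandVertex hi, weight_strandVertex hj, ← map_sub, ← map_zsmul]
  simp only [true_and]
  exact QuotientAddGroup.eq_zero_iff _

theorem addOrderOf_jacClass (hkp : Nat.Coprime k p) (hpk : p ≤ k) :
    addOrderOf (jacClass (thetaGraph n) (strandVertex n α (p * N)) (strandVertex n β (p * N')))
      = k := by
  have key : ∀ l : ℕ, addOrderOf (jacClass (thetaGraph n) (strandVertex n α (p * N))
      (strandVertex n β (p * N'))) ∣ l ↔ k ∣ l := fun l => by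
    rw [addOrderOf_dvd_iff_nsmul_eq_zero, ← Int.natCast_dvd_natCast,
      ← zsmul_linEquiv_zero_iff hn hαβ hk hN hN' hα hβ hkp hpk, LinEquiv, sub_zero, natCast_zsmul,
      Subtype.ext_iff]
    exact QuotientAddGroup.eq_zero_iff _
  exact Nat.dvd_antisymm ((key k).2 dvd_rfl) ((key _).1 dvd_rfl)

/-- A coset of the group generated by the marked class contains at most two vertices. -/
theorem exists_eq_of_coset (hpk : p ≤ k) {D : Divisor (thetaGraph n)}
    {x : Fin 3 → (thetaGraph n).vertexSet} {l : Fin 3 → ℤ}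
    (h : ∀ a, LinEquiv (thetaGraph n) (D + l a • (pt (thetaGraph n) (strandVertex n α (p * N)) -
      pt (thetaGraph n) (strandVertex n β (p * N')))) (pt (thetaGraph n) (x a))) :
    ∃ a b, a ≠ b ∧ x a = x b := by
  have hi : p * N ≤ n α := hα ▸ Nat.mul_le_mul_right N hpk
  have hj : p * N' ≤ n β := hβ ▸ Nat.mul_le_mul_right N' hpk
  choose γ t ht hx using fun a => exists_eq_strandVertex hn (x a)
  -- Pigeonhole: there are only two marked strands, so among three vertices two share a strand or
  -- one lies on the unmarked strand.
  obtain ⟨a, b, hab, hγ⟩ : ∃ a b, a ≠ b ∧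
      (γ a = γ b ∨ γ a ≠ α ∧ γ a ≠ β ∨ γ b ≠ α ∧ γ b ≠ β) := by
    by_contra! hcon
    have h01 := hcon 0 1 (by decide)
    have h02 := hcon 0 2 (by decide)
    have h12 := hcon 1 2 (by decide)
    grind
  refine ⟨a, b, hab, ?_⟩
  rw [hx a, hx b]
  refine strandVertex_eq_of_coset hn hαβ hk hN hN' hα hβ (p := p) hγ (ht a) (ht b)
    (l := l a - l b) ?_
  have ha := ((linEquiv_iff hn).1 (h a)).2
  have hb := ((linEquiv_iff hn).1 (h b)).2
  rw [hx, weight_strandVertex (ht _), map_add, map_zsmul, map_sub, weight_strandVertex hi,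
    weight_strandVertex hj, ← map_sub, ← map_zsmul] at ha hb
  rw [← mk_eq_mk_iff, map_sub, ← ha, ← hb, add_sub_add_left_eq_sub, ← map_sub, sub_smul]

end EvenlyMarked

/-! ### Twists of a divisor and classes of inversions. -/

section Transmission

variable {V E : Type*} {G : Graph V E} [Fintype G.vertexSet]

/-- The ranks of the twists of a divisor. -/
noncomputable def twistRank (u v : G.vertexSet) (D : Divisor G) (x y : ℤ) : ℤ :=
  rank G (D + x • pt G u - y • pt G v)

theorem delta_twist (u v : G.vertexSet) (D : Divisor G) (x y : ℤ) :
    delta G u v (D + x • pt G u - y • pt G v) =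
      twistRank u v D x y - twistRank u v D (x - 1) y - twistRank u v D x (y + 1)
        + twistRank u v D (x - 1) (y + 1) := by
  have h1 : D + x • pt G u - y • pt G v - pt G u = D + (x - 1) • pt G u - y • pt G v := by module
  have h2 : D + x • pt G u - y • pt G v - pt G v = D + x • pt G u - (y + 1) • pt G v := by module
  have h3 : D + (x - 1) • pt G u - y • pt G v - pt G v =
      D + (x - 1) • pt G u - (y + 1) • pt G v := by module
  simp only [delta, twistRank, h1, h2, h3]

theorem degree_twist (u v : G.vertexSet) (D : Divisor G) (x y : ℤ) :
    degree G (D + x • pt G u - y • pt G v) = x - y + degree G D := by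
  simp only [map_sub, map_add, map_zsmul, degree_pt, smul_eq_mul]
  ring

theorem LinEquiv.of_sub_zero {D D' F : Divisor G} (h : LinEquiv G F 0) (hD : D = D' + F) :
    LinEquiv G D D' := by
  unfold LinEquiv at *
  rwa [hD, add_sub_cancel_left, ← sub_zero F]

theorem invCount_le_two {k : ℕ} {τ : Equiv.Perm ℤ}
    (h : ∀ f : Fin 3 → Inversion τ, ∃ a b, a ≠ b ∧ inversionSetoid k τ (f a) (f b)) :
    invCount k τ ≤ 2 := by
  by_contra! hlt
  have h3 : 3 ≤ ENat.card (Quotient (inversionSetoid k τ)) := Order.add_one_le_of_lt hlt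
  have hne : Nonempty (Quotient (inversionSetoid k τ)) := by
    by_contra hemp
    rw [not_nonempty_iff] at hemp
    rw [(ENat.card_eq_zero_iff_empty _).2 hemp] at h3
    simp at h3
  obtain ⟨x⟩ := hne
  obtain ⟨y, hyx, -⟩ := ENat.exists_ne_ne_of_three_le h3 x x
  obtain ⟨z, hzx, hzy⟩ := ENat.exists_ne_ne_of_three_le h3 x y
  obtain ⟨a, b, hab, hr⟩ := h ![x.out, y.out, z.out]
  have hr := Quotient.sound hr
  fin_cases a <;> fin_cases b <;> simp_all

end Transmission

section ThetaGenus

variable {n : Fin 3 → ℕ}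

theorem genus_thetaGraph (hn : ∀ γ, 0 < n γ) : genus (thetaGraph n) = 2 := by
  have hE : (thetaGraph n).edgeSet = Set.univ := by
    refine Set.eq_univ_of_forall fun e => ?_
    exact ((thetaGraph n).edge_mem_iff_exists_isLink e).2
      ⟨bananaLabel n e.1 e.2, bananaLabel n e.1 (e.2 + 1), rfl⟩
  have hV : (thetaGraph n).vertexSet = Set.univ := rfl
  have h0 := hn 0
  have h1 := hn 1
  have h2 := hn 2
  rw [genus, hE, hV, Set.ncard_univ, Set.ncard_univ]
  simp [Fin.sum_univ_three]
  omega

end ThetaGenus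

/-! ### The transmission permutation and the bound on its inversions. -/

section Main

variable {n : Fin 3 → ℕ} (hn : ∀ γ, 0 < n γ) {α β : Fin 3} (hαβ : α ≠ β)
include hn hαβ

theorem exists_perm {i j : ℕ} (hi : 0 < i) (hin : i < n α) (hj : 0 < j) (hjn : j < n β)
    (D : Divisor (thetaGraph n)) : ∃ τ : Equiv.Perm ℤ, ∀ x y,
      twistRank (strandVertex n α i) (strandVertex n β j) D x y
        - twistRank (strandVertex n α i) (strandVertex n β j) D x (y + 1)
        = if τ y ≤ x then 1 else 0 :=
  exists_perm_of_submodular (d := degree (thetaGraph n) D)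
    (fun x y h => rank_eq_neg_one (by rwa [degree_twist]))
    (fun x y h => by rw [twistRank, rank_eq hn (by rwa [degree_twist]), degree_twist])
    (fun x y => by
      rw [← delta_twist]
      exact delta_nonneg hn hαβ hi hin hj hjn _)

theorem invCount_le {k p N N' : ℕ} (hkp : Nat.Coprime k p) (hp : 0 < p) (hpk : p < k) (hN : 0 < N)
    (hN' : 0 < N') (hα : n α = k * N) (hβ : n β = k * N') (D : Divisor (thetaGraph n))
    {τ : Equiv.Perm ℤ} (hτ : ∀ x y,
      twistRank (strandVertex n α (p * N)) (strandVertex n β (p * N')) D x y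
        - twistRank (strandVertex n α (p * N)) (strandVertex n β (p * N')) D x (y + 1)
        = if τ y ≤ x then 1 else 0) : invCount k τ ≤ 2 := by
  have hk : 0 < k := by omega
  have hin : p * N < n α := hα ▸ Nat.mul_lt_mul_of_pos_right hpk hN
  have hjn : p * N' < n β := hβ ▸ Nat.mul_lt_mul_of_pos_right hpk hN'
  have hord := zsmul_linEquiv_zero_iff hn hαβ hk hN hN' hα hβ hkp hpk.le
  have hcoset := fun {D x l} => exists_eq_of_coset hn hαβ hk hN hN' hα hβ hpk.le (D := D)
    (x := x) (l := l)
  have huv0 := rank_marked_le_zero hn hαβ (Nat.mul_pos hp hN) hin (Nat.mul_pos hp hN') hjn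
  generalize strandVertex n α (p * N) = u at *
  generalize strandVertex n β (p * N') = v at *
  set d := degree (thetaGraph n) D with hd
  have hbot : ∀ x y, -1 ≤ twistRank u v D x y := fun x y => neg_one_le_rank _
  have hge : ∀ x y, x - y + d - 2 ≤ twistRank u v D x y := fun x y => by
    have := degree_sub_two_le_rank hn (D + x • pt (thetaGraph n) u - y • pt (thetaGraph n) v)
    rwa [degree_twist] at this
  have hlarge : ∀ x y, 3 ≤ x - y + d → twistRank u v D x y = x - y + d - 2 := fun x y h => by
    rw [twistRank, rank_eq hn (by rwa [degree_twist]), degree_twist]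
  have hlt : ∀ x y, 1 ≤ x - y + d → twistRank u v D x y < x - y + d := fun x y h => by
    have := rank_lt_degree hn (D := D + x • pt (thetaGraph n) u - y • pt (thetaGraph n) v)
      (by rwa [degree_twist])
    rwa [degree_twist] at this
  have hpos : ∀ x y, 0 ≤ twistRank u v D x y → 0 ≤ x - y + d := fun x y h => by
    have := (rank_nonneg_iff.1 h).degree_nonneg
    rwa [degree_twist] at this
  have hmono : ∀ x y, twistRank u v D (x - 1) y ≤ twistRank u v D x y ∧
      twistRank u v D x y ≤ twistRank u v D (x - 1) y + 1 := fun x y => by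
    have h1 := rank_sub_pt_le (D + x • pt (thetaGraph n) u - y • pt (thetaGraph n) v) u
    have h2 := rank_sub_pt_ge (D + x • pt (thetaGraph n) u - y • pt (thetaGraph n) v) u
    rw [show D + x • pt (thetaGraph n) u - y • pt (thetaGraph n) v - pt (thetaGraph n) u =
      D + (x - 1) • pt (thetaGraph n) u - y • pt (thetaGraph n) v by module] at h1 h2
    exact ⟨h1, sub_le_iff_le_add.1 h2⟩
  -- An effective twist of degree `0` is trivial, so one more `u` and one more `v` give `u + v`,
  -- whose rank is at most `0`.
  have hmark : ∀ x y, x - y + d = 0 → 0 ≤ twistRank u v D x y →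
      twistRank u v D (x + 1) (y - 1) ≤ 0 := fun x y h h0 => by
    have h1 := linEquiv_zero_of_hasEffective (rank_nonneg_iff.1 h0) (by rwa [degree_twist])
    rw [twistRank, rank_congr (LinEquiv.of_sub_zero
      (D' := pt (thetaGraph n) u + pt (thetaGraph n) v)
      h1 (by module))]
    exact huv0
  refine invCount_le_two fun f => ?_
  choose y hpy hyq hqx hxp using fun a => exists_degree_one_row hτ hpos hlt hge hlarge hbot hmono
    hmark (f a).2.1 (f a).2.2
  have heff : ∀ a, ∃ w, LinEquiv (thetaGraph n) (D + (y a + 1 - d) • pt (thetaGraph n) u -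
      y a • pt (thetaGraph n) v) (pt (thetaGraph n) w) := fun a =>
    exists_linEquiv_pt (rank_nonneg_iff.1 (nonneg_of_below hτ hbot (hyq a) (hqx a)))
      (by rw [degree_twist]; ring)
  choose w hw using heff
  -- A twist of degree one is `D + (1 - d)u + y(u - v)`, so all of them lie in one coset of the
  -- marked class.
  obtain ⟨a, b, hab, hwab⟩ := hcoset (D := D + (1 - d) • pt (thetaGraph n) u) (x := w) (l := y)
    fun a => by
      convert hw a using 1
      module
  refine ⟨a, b, hab, ?_⟩
  have hz := (hw a).trans (hwab ▸ (hw b).symm)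
  have hdvd : (k : ℤ) ∣ y a - y b := (hord _).1 (by
    unfold LinEquiv at *
    convert hz using 1
    module)
  have hper : ∀ x z, twistRank u v D (x + (y a - y b)) (z + (y a - y b)) = twistRank u v D x z :=
    fun x z => rank_congr (LinEquiv.of_sub_zero ((hord _).2 hdvd) (by module))
  have hτe := apply_add_period hτ hper
  set e := y a - y b with he
  have hpb := hτe (f b).1.1
  have hqb := hτe (f b).1.2
  have h1 := hpy b
  have h2 := hyq b
  have h3 := hqx b
  have h4 := hxp b
  -- Translated by the period `e`, the inversion `f b` has the degree-one point of `f a` in its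
  -- rectangle, and so equals `f a`.
  obtain ⟨h5, h6⟩ := inversion_unique hτ hlt hge hbot (x := y a + 1 - d) (y := y a)
    (p' := (f b).1.1 + e) (q' := (f b).1.2 + e) (by ring) (hpy a) (hyq a) (hqx a) (hxp a)
    (by omega) (by omega) (by omega) (by omega)
  exact ⟨by omega, by rwa [h5, add_sub_cancel_left]⟩

end Main

end ChipFiring
theorem mainTheorem3 (n : Fin 3 → ℕ) (hn : ∀ α, 0 < n α) :
    -- marked vertices in the interiors of distinct strands
    (∀ (u v : (ChipFiring.thetaGraph n).vertexSet) (α β : Fin 3), α ≠ β →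
      ChipFiring.InStrandInterior n α u → ChipFiring.InStrandInterior n β v →
      ∀ D : ChipFiring.Divisor (ChipFiring.thetaGraph n),
        ChipFiring.Submodular (ChipFiring.thetaGraph n) u v D) ∧
    -- evenly marked theta graphs, cutting the strands in the ratio `a / b`
    (∀ (α β : Fin 3) (i j : ℕ), ChipFiring.EvenlyMarked n α i β j →
      ∀ a b : ℕ, 0 < a → 0 < b → (a : ℚ) / (b : ℚ) = (i : ℚ) / ((n α : ℚ) - (i : ℚ)) →
        addOrderOf (ChipFiring.jacClass (ChipFiring.thetaGraph n)
            (ChipFiring.strandVertex n α i) (ChipFiring.strandVertex n β j))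
          = (a + b) / Nat.gcd a b ∧
        ChipFiring.HasGeneralTransmission (ChipFiring.thetaGraph n)
          (ChipFiring.strandVertex n α i) (ChipFiring.strandVertex n β j)
          ((a + b) / Nat.gcd a b)) := by
  constructor
  · rintro u v α β hαβ ⟨i, hi, hin, rfl⟩ ⟨j, hj, hjn, rfl⟩ D a b
    exact ChipFiring.delta_nonneg hn hαβ hi hin hj hjn _
  · rintro α β i j ⟨hαβ, hi, hin, hij⟩ a b ha hb hab
    obtain ⟨p, N, N', hkp, hp, hpk, hN, hN', hα, rfl, hβ, rfl⟩ :=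
      ChipFiring.exists_even_parameters hi hin (hn β) hij ha hb hab
    generalize (a + b) / Nat.gcd a b = k at *
    have hk : 0 < k := by omega
    have hjn : p * N' < n β := hβ ▸ Nat.mul_lt_mul_of_pos_right hpk hN'
    refine ⟨ChipFiring.addOrderOf_jacClass hn hαβ hk hN hN' hα hβ hkp hpk.le, hk, ?_,
      fun D => ⟨fun x y => ChipFiring.delta_nonneg hn hαβ hi hin (Nat.mul_pos hp hN') hjn _, ?_⟩⟩
    · have h := (ChipFiring.zsmul_linEquiv_zero_iff hn hαβ hk hN hN' hα hβ hkp hpk.le k).2 dvd_rfl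
      unfold ChipFiring.LinEquiv at *
      rwa [sub_zero, natCast_zsmul, smul_sub] at h
    · obtain ⟨τ, hτ⟩ := ChipFiring.exists_perm hn hαβ hi hin (Nat.mul_pos hp hN') hjn D
      refine ⟨τ, fun x y => ?_, ?_⟩
      · rw [ChipFiring.delta_twist, ChipFiring.delta_eq_ite hτ]
      · rw [ChipFiring.genus_thetaGraph hn]
        exact ChipFiring.invCount_le hn hαβ hkp hp hpk hN hN' hα hβ D hτ
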